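/- Let $n\ge 1$, let $(z,s)$ be the coordinates on $\mathbb C^n\times\mathbb R\subset\mathbb C^n\times\mathbb C=\mathbb C^{n+1}$, and let $\Omega\subset\mathbb C^n\times\mathbb R$ be a bounded domain (nonempty connected open set) with smooth ($C^\infty$) boundary. A point $q$ of a real submanifold $M\subset\mathbb C^{n+1}$ is a CR singular point if the dimension of $T_p^cM=J(T_pM)\cap T_pM$ ($J$ = multiplication by $i$) is not constant for $p\in M$ near $q$. A CR singular point $(z_0,s_0)$ of $\partial\Omega\subset\mathbb C^{n+1}$ is called nondegenerate and elliptic if for some $\sigma\in\{1,-1\}$ the domain $\Omega$ is given near $(z_0,s_0)$ by $$\sigma(s-s_0)>Q(z-z_0)+E(z-z_0),\qquad Q(z)=\sum_{j,k=1}^n\bigl(a_{jk}z_j\bar z_k+b_{jk}z_jz_k+\bar b_{jk}\bar z_j\bar z_k\bigr),$$ where $E$ is smooth, real-valued and $O(\|z\|^3)$, $[b_{jk}]$ is symmetric, $[a_{jk}]$ is Hermitian, nonsingular and positive definite, and each set $\{z: Q(z)=c\}$ with $c\neq0$ is either empty or a real ellipsoid. Suppose that all CR singular points of $\partial\Omega$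 are nondegenerate and elliptic. Then 1. $\partial\Omega$ is homeomorphic to the sphere $S^{2n}$; 2. $\partial\Omega$ has exactly two CR singular points; 3. for each $c\in\mathbb R$ for which the slice $\Omega\cap(\mathbb C^n\times\{c\})$ is nonempty, this slice, as a subset of $\mathbb C^n$, is a smoothly bounded domain (a bounded domain with smooth boundary) with connected boundary. -/

import Mathlib

open Filter Topology
open scoped ContDiff ComplexOrder ComplexConjugate

/-- `Ω` has smooth boundary: near each of its boundary points it is a sublevel set `{ρ < 0}` of a
smooth real function `ρ` with nonvanishing differential at that point. -/
def HasSmoothBoundary {E : Type*} [NormedAddCommGroup E] [NormedSpace ℝ E] (Ω : Set E) : Prop :=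
  ∀ p ∈ frontier Ω, ∃ (U : Set E) (ρ : E → ℝ), IsOpen U ∧ p ∈ U ∧ ContDiffOn ℝ ∞ ρ U ∧
    fderiv ℝ ρ p ≠ 0 ∧ ∀ x ∈ U, x ∈ Ω ↔ ρ x < 0

/-- A smoothly bounded domain: a bounded, nonempty, connected open set with smooth boundary. -/
structure IsSmoothlyBoundedDomain {E : Type*} [NormedAddCommGroup E] [NormedSpace ℝ E]
    (Ω : Set E) : Prop where
  isOpen : IsOpen Ω
  isConnected : IsConnected Ω
  isBounded : Bornology.IsBounded Ω
  hasSmoothBoundary : HasSmoothBoundary Ω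

section CR

variable {F : Type*} [NormedAddCommGroup F] [NormedSpace ℂ F]

/-- The (real) tangent space `T_p M`, spanned by the velocities at `p` of smooth curves in `M`.
(For a smooth submanifold these velocities already form a linear subspace.) -/
noncomputable def realTangentSpace (M : Set F) (p : F) : Submodule ℝ F :=
  Submodule.span ℝ {v : F | ∃ (ε : ℝ) (γ : ℝ → F), 0 < ε ∧
    ContDiffOn ℝ ∞ γ (Set.Ioo (-ε) ε) ∧ (∀ t ∈ Set.Ioo (-ε) ε, γ t ∈ M) ∧
    γ 0 = p ∧ HasDerivAt γ v 0}

/-- The complex structure `J`, multiplication by `i`, as a real linear map. -/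
noncomputable def complexStructure (F : Type*) [NormedAddCommGroup F] [NormedSpace ℂ F] : F →ₗ[ℝ] F :=
  (LinearMap.lsmul ℂ F Complex.I).restrictScalars ℝ

/-- The complex tangent space `T_p^c M = J (T_p M) ∩ T_p M`. -/
noncomputable def complexTangentSpace (M : Set F) (p : F) : Submodule ℝ F :=
  (realTangentSpace M p).map (complexStructure F) ⊓ realTangentSpace M p

/-- `M` is CR at `q` if the dimension of `T_p^c M` is constant as `p ∈ M` varies near `q`. -/
def IsCRAt (M : Set F) (q : F) : Prop :=
  ∀ᶠ p in 𝓝[M] q,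
    Module.finrank ℝ (complexTangentSpace M p) = Module.finrank ℝ (complexTangentSpace M q)

/-- The set of CR singular (that is, non-CR) points of `M`. -/
def crSingularSet (M : Set F) : Set F :=
  {q | q ∈ M ∧ ¬ IsCRAt M q}

end CR

/-- The standard inclusion `ℂⁿ × ℝ ⊂ ℂⁿ × ℂ = ℂⁿ⁺¹`, `(z, s) ↦ (z, s)`. -/
def flatInclusion (n : ℕ) (x : EuclideanSpace ℂ (Fin n) × ℝ) :
    EuclideanSpace ℂ (Fin n) × ℂ :=
  (x.1, (x.2 : ℂ))

/-- The boundary of `Ω ⊂ ℂⁿ × ℝ`, as a submanifold of `ℂⁿ⁺¹`. -/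
def boundaryInCn {n : ℕ} (Ω : Set (EuclideanSpace ℂ (Fin n) × ℝ)) :
    Set (EuclideanSpace ℂ (Fin n) × ℂ) :=
  flatInclusion n '' frontier Ω

/-- The quadratic form
`Q(z, z̄) = ∑ a_{jk} z_j z̄_k + b_{jk} z_j z_k + conj(b_{jk}) z̄_j z̄_k`.
The sum is real when `A` is Hermitian, so that taking the real part changes nothing. -/
noncomputable def quadPart {n : ℕ} (A B : Matrix (Fin n) (Fin n) ℂ)
    (z : EuclideanSpace ℂ (Fin n)) : ℝ :=
  (∑ j, ∑ k, (A j k * (z j * conj (z k)) + B j k * (z j * z k)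
    + conj (B j k) * (conj (z j) * conj (z k)))).re

/-- A real ellipsoid in `ℂⁿ = ℝ²ⁿ`: the image of the unit sphere under an invertible
real affine map. -/
def IsRealEllipsoid {n : ℕ} (S : Set (EuclideanSpace ℂ (Fin n))) : Prop :=
  ∃ (x : EuclideanSpace ℂ (Fin n))
    (L : EuclideanSpace ℂ (Fin n) ≃L[ℝ] EuclideanSpace ℂ (Fin n)),
    S = (fun v => x + L v) '' Metric.sphere 0 1

/-- Near its boundary point `p = (z₀, s₀)`, the domain `Ω` is the side
`σ (s - s₀) > Q(z - z₀) + E(z - z₀)`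
of the graph `σ (s - s₀) = Q + E`, where `σ = ±1`, `Q` is the quadratic form with Hermitian matrix
`A` and symmetric matrix `B`, and `E` is smooth, real-valued and `O(3)`. -/
structure IsLocalForm {n : ℕ} (Ω : Set (EuclideanSpace ℂ (Fin n) × ℝ))
    (p : EuclideanSpace ℂ (Fin n) × ℝ) (σ : ℝ) (A B : Matrix (Fin n) (Fin n) ℂ)
    (E : EuclideanSpace ℂ (Fin n) → ℝ) : Prop where
  sign : σ = 1 ∨ σ = -1
  hermitian : A.IsHermitian
  symm : B.IsSymm
  smooth : ∃ U ∈ 𝓝 (0 : EuclideanSpace ℂ (Fin n)), ContDiffOn ℝ ∞ E U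
  cubic : E =O[𝓝 0] fun z => ‖z‖ ^ 3
  side : ∀ᶠ x in 𝓝 p, x ∈ Ω ↔ quadPart A B (x.1 - p.1) + E (x.1 - p.1) < σ * (x.2 - p.2)

/-- The level sets `{Q = c}` are empty or real ellipsoids; the level `c = 0`, where the ellipsoid
degenerates to the point `0`, is left out (the condition at the other levels implies
`{Q = 0} = {0}`). The orientation `σ` in the local form is normalized by `A` being positive
definite, so that `Ω` lies on the inner side of these ellipsoids. -/
def IsEllipticForm {n : ℕ} (A B : Matrix (Fin n) (Fin n) ℂ) : Prop :=
  A.PosDef ∧ ∀ c : ℝ, c ≠ 0 →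
    {z | quadPart A B z = c} = ∅ ∨ IsRealEllipsoid {z | quadPart A B z = c}

/-- The boundary of `Ω` has a nondegenerate (`[a_{jk}]` nonsingular) elliptic CR singularity
at `p`. -/
def IsNondegenerateEllipticAt {n : ℕ} (Ω : Set (EuclideanSpace ℂ (Fin n) × ℝ))
    (p : EuclideanSpace ℂ (Fin n) × ℝ) : Prop :=
  ∃ (σ : ℝ) (A B : Matrix (Fin n) (Fin n) ℂ) (E : EuclideanSpace ℂ (Fin n) → ℝ),
    IsLocalForm Ω p σ A B E ∧ A.det ≠ 0 ∧ IsEllipticForm A B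

/-- The slice `Ω ∩ (ℂⁿ × {c})`, as a subset of `ℂⁿ`. -/
def slice {n : ℕ} (Ω : Set (EuclideanSpace ℂ (Fin n) × ℝ)) (c : ℝ) :
    Set (EuclideanSpace ℂ (Fin n)) :=
  {z | (z, c) ∈ Ω}

/-!
The boundary is studied through the height `s` and a flow which raises it. A partition of unity
gives a global defining function `ρ` of `Ω` (`exists_global_definingFunction`). The field
`(-ρ_s ∇_z ρ, |∇_z ρ|² - ρ)` is tangent to the boundary, and on the closure of `Ω` its height
component is positive, except at the boundary points with horizontal tangent space, where the field
vanishes. Cut off far away, it generates a flow on the compact closure of `Ω`, which preserves `Ω`,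
raises the height along all nonconstant orbits, and rests exactly at these height-critical boundary
points (`exists_ascending_flow`).

The complex tangent space at a boundary point has complex dimension `n` if the point is
height-critical and `n - 1` otherwise. So the CR singular points are the height-critical points
which are not interior to the set of all such points (`flatInclusion_mem_crSingularSet`). This set
has in fact no interior: the interior would be a compact piece of the boundary with horizontal
tangent spaces, impossible at a maximum of a horizontal linear functional
(`not_eventually_isHeightCritical`).

The quadratic form of an elliptic point is positive definite, since its level sets are bounded and
the Hermitian part forces it to be positive somewhere (`quadPart_pos_of_isEllipticForm`). Near such
a point `Ω` is one side of the graph of a function which increases along rays, so the point is an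
isolated equilibrium of the flow and a strict local extremum of the height on the closed domain.
Basins of attraction of the local maxima are open, disjoint, and cover the connected set `Ω`; hence
there is only one maximum, and likewise only one minimum
(`IsStrictLyapunov.exists_source_sink`). These are the two CR singular points, and every other orbit
runs from the lower to the upper one, crossing each intermediate level exactly once.

Moving along the orbits to a given level is therefore continuous and maps slices onto slices, both
those of `Ω` and those of its boundary (`exists_levelProjection`). Just above the lowest point the
slice of `Ω` is star-shaped with a sphere as boundary (`IsEllipticPoint.exists_cap`), so all slices
and their boundaries are connected, like the sphere `S^{2n-1}` with `n ≥ 1`. The boundary of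
`Ω` is swept out by the levels of this sphere, collapsed to points at the two ends: it is the
suspension of `S^{2n-1}`, that is, `S^{2n}` (`exists_suspension_map`,
`nonempty_homeomorph_of_fibers_eq`).
-/

/-! ### Global flows of bounded Lipschitz fields -/

/-- A bounded Lipschitz field is complete, and its solutions form a continuous flow. Boundedness
makes the Picard–Lindelöf theorem applicable on all time intervals, uniformly in a ball of initial
values. -/
theorem exists_flow_of_lipschitzWith_of_norm_le {E : Type*} [NormedAddCommGroup E]
    [NormedSpace ℝ E] [CompleteSpace E] {X : E → E} {K C : NNReal} (hL : LipschitzWith K X)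
    (hC : ∀ x, ‖X x‖ ≤ C) :
    ∃ φ : Flow ℝ E, ∀ x t, HasDerivAt (fun t => φ t x) (X (φ t x)) t := by
  have hmem : ∀ n : ℕ, (0 : ℝ) ∈ Set.Icc (-(n + 1 : ℝ)) (n + 1 : ℝ) := fun n =>
    ⟨by linarith [n.cast_nonneg (α := ℝ)], by positivity⟩
  have hpl : ∀ (x : E) (n : ℕ), IsPicardLindelof (fun _ => X) (tmin := -(n + 1 : ℝ))
      (tmax := (n + 1 : ℝ)) ⟨0, hmem n⟩ x (C * (n + 1) + 1) 1 C K := fun x n =>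
    IsPicardLindelof.of_time_independent (fun x _ => hC x) hL.lipschitzOnWith (by simp)
  choose α hα hαc using fun x n =>
    (hpl x n).exists_forall_mem_closedBall_eq_hasDerivWithinAt_continuousOn
  have hder : ∀ (x₀ : E) (n : ℕ), ∀ x ∈ Metric.closedBall x₀ (1 : NNReal),
      ∀ t ∈ Set.Ioo (-(n + 1 : ℝ)) (n + 1),
      HasDerivAt (fun t => α x₀ n (x, t)) (X (α x₀ n (x, t))) t := fun x₀ n x hx t ht =>
    ((hα x₀ n x hx).2 t (Set.Ioo_subset_Icc_self ht)).hasDerivAt (Icc_mem_nhds ht.1 ht.2)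
  let γ : ℝ → E → E := fun t x => α x ⌈|t|⌉₊ (x, t)
  -- by uniqueness, the solutions on different time intervals fit together
  have hγ : ∀ (x₀ : E) (n : ℕ), ∀ x ∈ Metric.closedBall x₀ (1 : NNReal),
      ∀ t ∈ Set.Ioo (-(n + 1 : ℝ)) (n + 1), α x₀ n (x, t) = γ t x := by
    intro x₀ n x hx t ht
    set N := ⌈|t|⌉₊ with hN
    have hx' : x ∈ Metric.closedBall x (1 : NNReal) := Metric.mem_closedBall_self (by simp)
    have htN : |t| < N + 1 := lt_of_le_of_lt (Nat.le_ceil _) (lt_add_one _)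
    have htn : |t| < n + 1 := abs_lt.2 ht
    set m : ℝ := min (n + 1) (N + 1) with hm
    have hm0 : 0 < m := lt_min n.cast_add_one_pos N.cast_add_one_pos
    have h1 : ∀ τ ∈ Set.Ioo (-m) m, τ ∈ Set.Ioo (-(n + 1 : ℝ)) (n + 1) := fun τ hτ =>
      ⟨by linarith [hτ.1, min_le_left (n + 1 : ℝ) (N + 1)],
        by linarith [hτ.2, min_le_left (n + 1 : ℝ) (N + 1)]⟩
    have h2 : ∀ τ ∈ Set.Ioo (-m) m, τ ∈ Set.Ioo (-(N + 1 : ℝ)) (N + 1) := fun τ hτ =>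
      ⟨by linarith [hτ.1, min_le_right (n + 1 : ℝ) (N + 1)],
        by linarith [hτ.2, min_le_right (n + 1 : ℝ) (N + 1)]⟩
    refine ODE_solution_unique_of_mem_Ioo (v := fun _ => X) (s := fun _ => Set.univ) (t₀ := 0)
      (K := K) (a := -m) (b := m) (f := fun t => α x₀ n (x, t)) (g := fun t => α x N (x, t))
      (fun _ _ => hL.lipschitzOnWith) ⟨by linarith, hm0⟩
      (fun τ hτ => ⟨hder x₀ n x hx τ (h1 τ hτ), trivial⟩)
      (fun τ hτ => ⟨hder x N x hx' τ (h2 τ hτ), trivial⟩) ?_ (abs_lt.1 (lt_min htn htN))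
    exact ((hα x₀ n x hx).1).trans ((hα x N x hx').1).symm
  have hIoo : ∀ t : ℝ, t ∈ Set.Ioo (-((⌈|t|⌉₊ : ℕ) + 1 : ℝ)) ((⌈|t|⌉₊ : ℕ) + 1) := fun t =>
    abs_lt.1 (lt_of_le_of_lt (Nat.le_ceil _) (lt_add_one _))
  have hself : ∀ x : E, x ∈ Metric.closedBall x (1 : NNReal) := fun x =>
    Metric.mem_closedBall_self (by simp)
  have hγd : ∀ x t, HasDerivAt (fun t => γ t x) (X (γ t x)) t := by
    intro x t
    refine (hder x ⌈|t|⌉₊ x (hself x) t (hIoo t)).congr_of_eventuallyEq ?_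
    filter_upwards [Ioo_mem_nhds (hIoo t).1 (hIoo t).2] with τ hτ
    exact (hγ x _ x (hself x) τ hτ).symm
  have hγ0 : ∀ x, γ 0 x = x := fun x => (hα x _ x (hself x)).1
  refine ⟨⟨γ, ?_, ?_, hγ0⟩, hγd⟩
  · rw [continuous_iff_continuousAt]
    rintro ⟨t, x⟩
    have h1 : ContinuousAt (α x ⌈|t|⌉₊) (x, t) := (hαc x ⌈|t|⌉₊).continuousAt
      (prod_mem_nhds (Metric.closedBall_mem_nhds x (by simp)) (Icc_mem_nhds (hIoo t).1 (hIoo t).2))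
    have h2 : ContinuousAt (fun p : ℝ × E => α x ⌈|t|⌉₊ (p.2, p.1)) (t, x) :=
      ContinuousAt.comp (f := fun p : ℝ × E => (p.2, p.1)) h1 (by fun_prop)
    refine h2.congr ?_
    filter_upwards [prod_mem_nhds (Ioo_mem_nhds (hIoo t).1 (hIoo t).2)
      (Metric.closedBall_mem_nhds x (show (0 : ℝ) < (1 : NNReal) by simp))] with p hp
    exact hγ x _ p.2 hp.2 p.1 hp.1
  · intro t₁ t₂ x
    refine congrFun (ODE_solution_unique_univ (v := fun _ => X) (s := fun _ => Set.univ) (t₀ := 0)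
      (K := K) (f := fun t => γ (t + t₂) x) (g := fun t => γ t (γ t₂ x))
      (fun _ => hL.lipschitzOnWith)
      (fun t => ⟨by simpa using (hγd x (t + t₂)).comp_add_const t t₂, trivial⟩)
      (fun t => ⟨hγd _ t, trivial⟩) ?_) t₁
    simp [hγ0]

/-! ### Equilibria and basins of gradient-like flows -/

section Dynamics

variable {K : Type*} [TopologicalSpace K]

/-- An equilibrium of a flow: a point fixed at all times. -/
def IsEquilibrium (φ : Flow ℝ K) (x : K) : Prop := ∀ t, φ t x = x

/-- A strict Lyapunov function: continuous, and strictly decreasing along every orbit which is not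
an equilibrium. -/
structure IsStrictLyapunov (φ : Flow ℝ K) (h : K → ℝ) : Prop where
  continuous : Continuous h
  lt : ∀ x, ¬ IsEquilibrium φ x → ∀ t > 0, h (φ t x) < h x

/-- A strict local minimum of `h`, isolated among the equilibria of `φ`. -/
structure IsIsolatedSink (φ : Flow ℝ K) (h : K → ℝ) (e : K) : Prop where
  isEquilibrium : IsEquilibrium φ e
  isolated : ∀ᶠ y in 𝓝[≠] e, ¬ IsEquilibrium φ y
  lt : ∀ᶠ y in 𝓝[≠] e, h e < h y

theorem Flow.neg_apply_apply (φ : Flow ℝ K) (t : ℝ) (x : K) : φ (-t) (φ t x) = x := by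
  rw [← φ.map_add, neg_add_cancel, φ.map_zero_apply]

theorem Flow.apply_neg_apply (φ : Flow ℝ K) (t : ℝ) (x : K) : φ t (φ (-t) x) = x := by
  rw [← φ.map_add, add_neg_cancel, φ.map_zero_apply]

theorem IsEquilibrium.of_apply {φ : Flow ℝ K} {t : ℝ} {x : K} (h : IsEquilibrium φ (φ t x)) :
    IsEquilibrium φ x := by
  have : x = φ t x := (φ.neg_apply_apply t x).symm.trans (h (-t))
  rwa [← this] at h

namespace IsStrictLyapunov

variable {φ : Flow ℝ K} {h : K → ℝ}

theorem antitone (hh : IsStrictLyapunov φ h) (x : K) : Antitone fun t => h (φ t x) := by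
  intro s t hst
  rcases hst.eq_or_lt with rfl | hst
  · rfl
  have ht : φ t x = φ (t - s) (φ s x) := by rw [← φ.map_add, sub_add_cancel]
  by_cases hx : IsEquilibrium φ (φ s x)
  · simp only [ht, hx (t - s), le_refl]
  · simpa only [ht] using (hh.lt _ hx _ (sub_pos.2 hst)).le

/-- LaSalle's invariance principle: orbits accumulate at equilibria. -/
theorem exists_mapClusterPt [CompactSpace K] (hh : IsStrictLyapunov φ h) (x : K) :
    ∃ y, IsEquilibrium φ y ∧ MapClusterPt y atTop (fun t => φ t x) ∧ ∀ t, h y ≤ h (φ t x) := by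
  obtain ⟨y, hy⟩ := exists_clusterPt_of_compactSpace (map (fun t => φ t x) atTop)
  have hy : MapClusterPt y atTop (fun t => φ t x) := hy
  have hle : ∀ t, h y ≤ h (φ t x) := by
    intro t
    by_contra! hlt
    have h1 := hy.frequently (hh.continuous.continuousAt.eventually (lt_mem_nhds hlt))
    obtain ⟨τ, h2, h3⟩ := (h1.and_eventually (eventually_ge_atTop t)).exists
    exact absurd (hh.antitone x h3) (not_le.2 h2)
  refine ⟨y, ?_, hy, hle⟩
  by_contra hne
  have h1 : ∀ᶠ z in 𝓝 y, h (φ 1 z) < h y :=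
    (hh.continuous.comp (φ.continuous_toFun 1)).continuousAt.eventually
      (gt_mem_nhds (hh.lt y hne 1 one_pos))
  obtain ⟨τ, hτ⟩ := (hy.frequently h1).exists
  rw [← φ.map_add] at hτ
  exact absurd (hle _) (not_le.2 hτ)

end IsStrictLyapunov

namespace IsIsolatedSink

variable [CompactSpace K] [T2Space K] {φ : Flow ℝ K} {h : K → ℝ} {e : K}

/-- Lyapunov stability of a sink. -/
theorem stable (he : IsIsolatedSink φ h e) (hh : IsStrictLyapunov φ h) {W : Set K}
    (hW : W ∈ 𝓝 e) : ∀ᶠ x in 𝓝 e, ∀ t ≥ 0, φ t x ∈ W := by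
  have h1 : {y | y ≠ e → h e < h y} ∈ 𝓝 e := eventually_nhdsWithin_iff.1 he.lt
  obtain ⟨C, hC, hCc, hCW⟩ := exists_mem_nhds_isClosed_subset (inter_mem hW h1)
  have hS : IsCompact (C \ interior C) := (hCc.sdiff isOpen_interior).isCompact
  have hlt : ∀ y ∈ C \ interior C, h e < h y := fun y hy =>
    (hCW hy.1).2 fun h => hy.2 (h ▸ mem_interior_iff_mem_nhds.2 hC)
  -- a level above `h e` that the orbit has to reach in order to leave `C`
  obtain ⟨c, hec, hc⟩ : ∃ c, h e < c ∧ ∀ y ∈ C \ interior C, c ≤ h y := by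
    rcases (C \ interior C).eq_empty_or_nonempty with h0 | h0
    · exact ⟨h e + 1, by linarith, by simp [h0]⟩
    · obtain ⟨y, hy, hmin⟩ := hS.exists_isMinOn h0 hh.continuous.continuousOn
      exact ⟨h y, hlt y hy, hmin⟩
  filter_upwards [interior_mem_nhds.2 hC, hh.continuous.continuousAt.eventually (gt_mem_nhds hec)]
    with x hx hxc t ht
  have hpre : IsPreconnected ((fun t => φ t x) '' Set.Ici 0) :=
    isPreconnected_Ici.image _ (by fun_prop)
  have hsub : (fun t => φ t x) '' Set.Ici 0 ⊆ interior C := by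
    refine hpre.subset_left_of_subset_union isOpen_interior hCc.isOpen_compl ?_ ?_
      ⟨x, ⟨0, by simp, by simp⟩, hx⟩
    · exact Set.disjoint_compl_right_iff_subset.2 interior_subset
    · rintro _ ⟨τ, hτ, rfl⟩
      by_contra hcon
      simp only [Set.mem_union, Set.mem_compl_iff, not_or, not_not] at hcon
      have h2 := hc _ ⟨hcon.2, hcon.1⟩
      have h3 := hh.antitone x hτ
      simp only [φ.map_zero_apply] at h3
      linarith
  exact (hCW (interior_subset (hsub ⟨t, ht, rfl⟩))).1

theorem tendsto_of_mapClusterPt (he : IsIsolatedSink φ h e) (hh : IsStrictLyapunov φ h) {x : K}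
    (hx : MapClusterPt e atTop fun t => φ t x) : Tendsto (fun t => φ t x) atTop (𝓝 e) := by
  refine tendsto_def.2 fun W hW => ?_
  obtain ⟨τ, hτ⟩ := (hx.frequently (he.stable hh hW)).exists
  filter_upwards [eventually_ge_atTop τ] with t ht
  have := hτ (t - τ) (sub_nonneg.2 ht)
  rwa [← φ.map_add, sub_add_cancel] at this

/-- Asymptotic stability of a sink. -/
theorem attracting (he : IsIsolatedSink φ h e) (hh : IsStrictLyapunov φ h) :
    ∀ᶠ x in 𝓝 e, Tendsto (fun t => φ t x) atTop (𝓝 e) := by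
  obtain ⟨C, hC, hCc, hCW⟩ :=
    exists_mem_nhds_isClosed_subset (eventually_nhdsWithin_iff.1 he.isolated)
  filter_upwards [he.stable hh hC] with x hx
  obtain ⟨y, hye, hy, -⟩ := hh.exists_mapClusterPt x
  have hyC : y ∈ C := by
    by_contra hne
    obtain ⟨t, ht, ht0⟩ := ((hy.frequently (hCc.isOpen_compl.mem_nhds hne)).and_eventually
      (eventually_ge_atTop 0)).exists
    exact ht (hx t ht0)
  have hyeq : y = e := by
    by_contra hne
    exact hCW hyC hne hye
  exact he.tendsto_of_mapClusterPt hh (hyeq ▸ hy)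

/-- The basin of attraction of a sink is open. -/
theorem isOpen_basin (he : IsIsolatedSink φ h e) (hh : IsStrictLyapunov φ h) :
    IsOpen {x | Tendsto (fun t => φ t x) atTop (𝓝 e)} := by
  rw [isOpen_iff_mem_nhds]
  intro x hx
  obtain ⟨τ, hτ⟩ := (hx.eventually (eventually_eventually_nhds.2 (he.attracting hh))).exists
  filter_upwards [(φ.continuous_toFun τ).continuousAt.eventually hτ] with y hy
  have h1 := hy.comp (tendsto_atTop_add_const_right _ (-τ) tendsto_id)
  refine h1.congr fun t => ?_
  simp only [Function.comp, id, ← φ.map_add]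
  congr 1
  ring

end IsIsolatedSink

variable [CompactSpace K] [T2Space K] {φ : Flow ℝ K} {h : K → ℝ}

/-- If every equilibrium is an isolated strict local extremum of a strict Lyapunov function, and a
connected set free of equilibria is dense, then a single sink attracts everything but the local
maxima: the basins of the sinks cut the connected set into disjoint open pieces. -/
theorem IsStrictLyapunov.exists_sink (hh : IsStrictLyapunov φ h)
    (hext : ∀ e, IsEquilibrium φ e → IsIsolatedSink φ h e ∨ ∀ᶠ y in 𝓝[≠] e, h y < h e)
    {Ω : Set K} (hΩ : IsConnected Ω) (hd : Dense Ω) (hΩe : ∀ x ∈ Ω, ¬ IsEquilibrium φ x) :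
    ∃ p, IsEquilibrium φ p ∧
      ∀ x, (IsEquilibrium φ x ∧ ∀ᶠ y in 𝓝[≠] x, h y < h x) ∨
        Tendsto (fun t => φ t x) atTop (𝓝 p) := by
  have hcov : ∀ x, (IsEquilibrium φ x ∧ ∀ᶠ y in 𝓝[≠] x, h y < h x) ∨
      ∃ e, IsIsolatedSink φ h e ∧ Tendsto (fun t => φ t x) atTop (𝓝 e) := by
    intro x
    obtain ⟨y, hye, hy, hle⟩ := hh.exists_mapClusterPt x
    rcases hext y hye with h1 | h1
    · exact Or.inr ⟨y, h1, h1.tendsto_of_mapClusterPt hh hy⟩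
    · left
      obtain ⟨τ, hτ⟩ := (hy.frequently (eventually_nhdsWithin_iff.1 h1)).exists
      -- the orbit stays above the level of `y`, so it can be near `y` only by being at `y`
      have hτy : φ τ x = y := by
        by_contra hne
        exact absurd (hτ hne) (not_lt.2 (hle τ))
      have hxy : x = y := by rw [← φ.neg_apply_apply τ x, hτy, hye]
      exact hxy ▸ ⟨hye, h1⟩
  have hcovΩ : ∀ x ∈ Ω, ∃ e, IsIsolatedSink φ h e ∧ Tendsto (fun t => φ t x) atTop (𝓝 e) :=
    fun x hx => (hcov x).resolve_left fun h => hΩe x hx h.1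
  obtain ⟨x₀, hx₀⟩ := hΩ.nonempty
  obtain ⟨p, hp, hx₀p⟩ := hcovΩ x₀ hx₀
  have hall : Ω ⊆ {x | Tendsto (fun t => φ t x) atTop (𝓝 p)} := by
    refine hΩ.isPreconnected.subset_left_of_subset_union (hp.isOpen_basin hh)
      (v := ⋃ e : {e // IsIsolatedSink φ h e ∧ e ≠ p},
        {x | Tendsto (fun t => φ t x) atTop (𝓝 e.1)})
      (isOpen_iUnion fun e => e.2.1.isOpen_basin hh) ?_ ?_ ⟨x₀, hx₀, hx₀p⟩
    · rw [Set.disjoint_left]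
      rintro x hx hx'
      obtain ⟨e, he⟩ := Set.mem_iUnion.1 hx'
      exact e.2.2 (tendsto_nhds_unique he hx)
    · intro x hx
      obtain ⟨e, he, hxe⟩ := hcovΩ x hx
      by_cases hep : e = p
      · exact Or.inl (hep ▸ hxe)
      · exact Or.inr (Set.mem_iUnion.2 ⟨⟨e, he, hep⟩, hxe⟩)
  refine ⟨p, hp.isEquilibrium, fun x => (hcov x).imp_right ?_⟩
  rintro ⟨e, he, hxe⟩
  obtain ⟨y, hye, hyΩ⟩ := hd.inter_open_nonempty _ (he.isOpen_basin hh) ⟨x, hxe⟩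
  exact tendsto_nhds_unique hye (hall hyΩ) ▸ hxe

theorem isEquilibrium_reverse {K : Type*} [TopologicalSpace K] {φ : Flow ℝ K} {x : K} :
    IsEquilibrium φ.reverse x ↔ IsEquilibrium φ x :=
  ⟨fun h t => by simpa using h (-t), fun h t => h (-t)⟩

/-- If every equilibrium is an isolated strict local extremum of a strict Lyapunov function, and a
connected set free of equilibria is dense, then there are only two equilibria, a source and a sink,
and every other orbit runs from the one to the other. -/
theorem IsStrictLyapunov.exists_source_sink (hh : IsStrictLyapunov φ h)
    (hext : ∀ e, IsEquilibrium φ e → (∀ᶠ y in 𝓝[≠] e, ¬ IsEquilibrium φ y) ∧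
      ((∀ᶠ y in 𝓝[≠] e, h e < h y) ∨ ∀ᶠ y in 𝓝[≠] e, h y < h e))
    {Ω : Set K} (hΩ : IsConnected Ω) (hd : Dense Ω) (hΩe : ∀ x ∈ Ω, ¬ IsEquilibrium φ x) :
    ∃ p q, IsEquilibrium φ p ∧ IsEquilibrium φ q ∧ (∀ x, IsEquilibrium φ x → x = p ∨ x = q) ∧
      ∀ x, ¬ IsEquilibrium φ x → Tendsto (fun t => φ t x) atTop (𝓝 p) ∧
        Tendsto (fun t => φ t x) atBot (𝓝 q) ∧ h p < h x ∧ h x < h q := by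
  have hh' : IsStrictLyapunov φ.reverse (fun x => -h x) := by
    refine ⟨hh.continuous.neg, fun x hx t ht => neg_lt_neg ?_⟩
    have := hh.lt (φ (-t) x) (fun h => hx (isEquilibrium_reverse.2 h.of_apply)) t ht
    rwa [φ.apply_neg_apply] at this
  obtain ⟨p, hp, hpx⟩ := hh.exists_sink
    (fun e he => (hext e he).2.imp_left fun h => ⟨he, (hext e he).1, h⟩) hΩ hd hΩe
  obtain ⟨q, hq, hqx⟩ := hh'.exists_sink (Ω := Ω) (fun e he => by
    have he' := isEquilibrium_reverse.1 he
    refine (hext e he').2.symm.imp (fun h => ⟨he, ?_, by simpa using h⟩) fun h => by simpa using h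
    simpa only [isEquilibrium_reverse] using (hext e he').1) hΩ hd
    (fun x hx => by simpa only [isEquilibrium_reverse] using hΩe x hx)
  simp only [isEquilibrium_reverse, neg_lt_neg_iff] at hq hqx
  have hqx' : ∀ x, ¬ IsEquilibrium φ x → Tendsto (fun t => φ t x) atBot (𝓝 q) := fun x hx => by
    have := ((hqx x).resolve_left fun h => hx h.1).comp tendsto_neg_atBot_atTop
    simpa [Function.comp_def] using this
  have hpx' : ∀ x, ¬ IsEquilibrium φ x → Tendsto (fun t => φ t x) atTop (𝓝 p) := fun x hx =>
    (hpx x).resolve_left fun h => hx h.1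
  refine ⟨p, q, hp, hq, fun x hx => ?_, fun x hx => ⟨hpx' x hx, hqx' x hx, ?_, ?_⟩⟩
  · by_contra! hne
    have hconst : ∀ (r : K) (l : Filter ℝ) [l.NeBot], Tendsto (fun t => φ t x) l (𝓝 r) → x = r := by
      intro r l _ h
      simp only [hx _] at h
      exact tendsto_nhds_unique tendsto_const_nhds h
    have h1 := ((hpx x).resolve_right fun h => hne.1 (hconst p _ h)).2
    have h2 := ((hqx x).resolve_right fun h => hne.2 (by
      simp only [Flow.reverse_apply, hx _] at h
      exact tendsto_nhds_unique tendsto_const_nhds h)).2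
    -- a point which is both a strict maximum and a strict minimum is isolated
    have h3 : {x} ∈ 𝓝 x := by
      filter_upwards [eventually_nhdsWithin_iff.1 h1, eventually_nhdsWithin_iff.1 h2] with y h1 h2
      by_contra hy
      exact lt_asymm (h1 hy) (h2 hy)
    obtain ⟨y, hy, hyΩ⟩ := hd.inter_open_nonempty _ (isOpen_interior (s := {x}))
      ⟨x, mem_interior_iff_mem_nhds.2 h3⟩
    exact hΩe y hyΩ (interior_subset hy ▸ hx)
  · have h1 : h p ≤ h (φ 1 x) := le_of_tendsto ((hh.continuous.tendsto p).comp (hpx' x hx))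
      ((eventually_ge_atTop 1).mono fun t ht => hh.antitone x ht)
    exact h1.trans_lt (hh.lt x hx 1 one_pos)
  · have h1 : h (φ (-1) x) ≤ h q := ge_of_tendsto ((hh.continuous.tendsto q).comp (hqx' x hx))
      ((eventually_le_atBot (-1)).mono fun t ht => hh.antitone x ht)
    have h2 := hh.lt (φ (-1) x) (fun h => hx h.of_apply) 1 one_pos
    rw [φ.apply_neg_apply] at h2
    exact h2.trans_le h1

end Dynamics

/-! ### Global defining functions -/

section DefiningFunction

variable {E : Type*} [NormedAddCommGroup E] [NormedSpace ℝ E] {Ω : Set E} {x v : E}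
  {ρ ρ' : E → ℝ} {ℓ ℓ' : E →L[ℝ] ℝ}

theorem eq_zero_of_mem_frontier_of_eventually {E : Type*} [TopologicalSpace E] {Ω : Set E} {x : E}
    {ρ : E → ℝ} (hΩ : IsOpen Ω) (hx : x ∈ frontier Ω)
    (hc : ContinuousAt ρ x) (hρ : ∀ᶠ y in 𝓝 x, y ∈ Ω ↔ ρ y < 0) : ρ x = 0 := by
  rw [hΩ.frontier_eq] at hx
  refine le_antisymm ?_ (not_lt.1 fun h => hx.2 (hρ.self_of_nhds.2 h))
  by_contra! h
  obtain ⟨y, hy, h1, h2⟩ := ((mem_closure_iff_frequently.1 hx.1).and_eventually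
    (hρ.and (hc.eventually (lt_mem_nhds h)))).exists
  exact lt_asymm h2 (h1.1 hy)

theorem HasFDerivAt.eventually_neg_of_apply_neg (h : HasFDerivAt ρ ℓ x) (h0 : ρ x = 0)
    (hv : ℓ v < 0) : ∀ᶠ t : ℝ in 𝓝[>] 0, ρ (x + t • v) < 0 := by
  have h1 : HasDerivAt (fun t : ℝ => ρ (x + t • v)) (ℓ v) 0 := by
    have h2 : HasDerivAt (fun t : ℝ => x + t • v) v 0 := by
      simpa using ((hasDerivAt_id (0 : ℝ)).smul_const v).const_add x
    have h3 : HasFDerivAt ρ ℓ (x + (0 : ℝ) • v) := by simpa using h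
    exact h3.comp_hasDerivAt 0 h2
  have h2 := (hasDerivAt_iff_tendsto_slope.1 h1).mono_left
    (nhdsWithin_mono 0 fun t (ht : 0 < t) => ht.ne')
  filter_upwards [h2.eventually (gt_mem_nhds hv), self_mem_nhdsWithin] with t ht ht0
  have ht0 : 0 < t := ht0
  simp only [slope_def_field, zero_smul, add_zero, h0, sub_zero] at ht
  by_contra! hcon
  exact absurd ht (not_lt.2 (div_nonneg hcon ht0.le))

theorem tendsto_add_smul_nhdsGT (x v : E) : Tendsto (fun t : ℝ => x + t • v) (𝓝[>] 0) (𝓝 x) := by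
  have : ContinuousAt (fun t : ℝ => x + t • v) 0 := by fun_prop
  simpa using this.tendsto.mono_left nhdsWithin_le_nhds

/-- If `{ρ < 0} ⊆ {ρ' < 0}` near a common zero, then the open half space `ℓ < 0` of the
differential of `ρ` is contained in the closed half space `ℓ' ≤ 0` of that of `ρ'`. -/
theorem apply_nonpos_of_apply_neg (hρ : HasFDerivAt ρ ℓ x) (hρ' : HasFDerivAt ρ' ℓ' x)
    (h0 : ρ x = 0) (h0' : ρ' x = 0) (h : ∀ᶠ y in 𝓝 x, ρ y < 0 → ρ' y < 0) (hv : ℓ v < 0) :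
    ℓ' v ≤ 0 := by
  by_contra! hv'
  have h1 := hρ'.neg.eventually_neg_of_apply_neg (v := v) (by simp [h0']) (by simpa using hv')
  obtain ⟨t, h2, h3, h4⟩ := ((hρ.eventually_neg_of_apply_neg h0 hv).and
    (h1.and ((tendsto_add_smul_nhdsGT x v).eventually h))).exists
  simp only [Pi.neg_apply] at h3
  linarith [h4 h2]

theorem exists_apply_neg_of_ne_zero (hℓ : ℓ ≠ 0) : ∃ w, ℓ w < 0 := by
  obtain ⟨w, hw⟩ := DFunLike.ne_iff.1 hℓ
  rw [zero_apply] at hw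
  rcases hw.lt_or_gt with h | h
  · exact ⟨w, h⟩
  · exact ⟨-w, by simpa using h⟩

theorem apply_eq_zero_of_apply_eq_zero (hρ : HasFDerivAt ρ ℓ x) (hρ' : HasFDerivAt ρ' ℓ' x)
    (h0 : ρ x = 0) (h0' : ρ' x = 0) (h : ∀ᶠ y in 𝓝 x, ρ y < 0 → ρ' y < 0) (hℓ : ℓ ≠ 0)
    (hv : ℓ v = 0) : ℓ' v = 0 := by
  obtain ⟨w, hw⟩ := exists_apply_neg_of_ne_zero hℓ
  have key : ∀ u, ℓ u = 0 → ℓ' u ≤ 0 := by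
    intro u hu
    by_contra! hpos
    -- push `u` slightly into the open half space `ℓ < 0`
    obtain ⟨ε, hε, h2⟩ : ∃ ε > 0, 0 < ℓ' u + ε * ℓ' w := by
      refine ⟨ℓ' u / (2 * (|ℓ' w| + 1)), by positivity, ?_⟩
      have h3 : ℓ' u / (2 * (|ℓ' w| + 1)) * (|ℓ' w| + 1) = ℓ' u / 2 := by field_simp
      have h4 : 0 < ℓ' u / (2 * (|ℓ' w| + 1)) := by positivity
      nlinarith [neg_abs_le (ℓ' w)]
    have h3 := apply_nonpos_of_apply_neg (v := u + ε • w) hρ hρ' h0 h0' h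
      (by simpa [hu] using mul_neg_of_pos_of_neg hε hw)
    simp at h3
    linarith
  refine le_antisymm (key v hv) ?_
  simpa using key (-v) (by simp [hv])

/-- Two defining functions of the same open set have differentials which are positive multiples of
one another. -/
theorem apply_neg_of_apply_neg (hρ : HasFDerivAt ρ ℓ x) (hρ' : HasFDerivAt ρ' ℓ' x)
    (h0 : ρ x = 0) (h0' : ρ' x = 0) (h : ∀ᶠ y in 𝓝 x, ρ y < 0 ↔ ρ' y < 0)
    (hℓ' : ℓ' ≠ 0) (hv : ℓ v < 0) : ℓ' v < 0 := by
  refine lt_of_le_of_ne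
    (apply_nonpos_of_apply_neg hρ hρ' h0 h0' (h.mono fun _ h => h.1) hv) fun h1 => hv.ne ?_
  exact apply_eq_zero_of_apply_eq_zero hρ' hρ h0' h0 (h.mono fun _ h => h.2) hℓ' h1

/-- A set with smooth boundary has a global smooth defining function. It is a convex combination of
local ones; on the boundary the differentials of these are positive multiples of one another, so
that its own differential does not vanish there. -/
theorem exists_global_definingFunction [FiniteDimensional ℝ E] (hΩ : IsOpen Ω)
    (hb : HasSmoothBoundary Ω) :
    ∃ ρ : E → ℝ, ContDiff ℝ ∞ ρ ∧ (∀ x, x ∈ Ω ↔ ρ x < 0) ∧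
      ∀ x ∈ frontier Ω, ρ x = 0 ∧ fderiv ℝ ρ x ≠ 0 := by
  choose! U r hUo hpU hr hdr hside using hb
  let V : frontier Ω → Set E := fun p => U p ∩ (fun x => fderiv ℝ (r p) x) ⁻¹' {0}ᶜ
  have hV : ∀ p, IsOpen (V p) := fun p =>
    ((hr p p.2).continuousOn_fderiv_of_isOpen (hUo p p.2) (by simp)).isOpen_inter_preimage
      (hUo p p.2) isOpen_compl_singleton
  let W : Option (Option (frontier Ω)) → Set E
    | none => Ω
    | some none => (closure Ω)ᶜ
    | some (some p) => V p
  let g : Option (Option (frontier Ω)) → E → ℝ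
    | none => fun _ => -1
    | some none => fun _ => 1
    | some (some p) => r p
  have hWo : ∀ i, IsOpen (W i) := by
    rintro (_ | _ | p)
    exacts [hΩ, isClosed_closure.isOpen_compl, hV p]
  have hWu : Set.univ ⊆ ⋃ i, W i := by
    intro x _
    rw [Set.mem_iUnion]
    by_cases hx : x ∈ Ω
    · exact ⟨none, hx⟩
    by_cases hx' : x ∈ closure Ω
    · have hf : x ∈ frontier Ω := hΩ.frontier_eq ▸ ⟨hx', hx⟩
      exact ⟨some (some ⟨x, hf⟩), hpU x hf, hdr x hf⟩
    · exact ⟨some none, hx'⟩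
  obtain ⟨f, hf⟩ := SmoothPartitionOfUnity.exists_isSubordinate (modelWithCornersSelf ℝ E)
    isClosed_univ W hWo hWu
  have hg : ∀ i, ContDiffOn ℝ ∞ (g i) (W i) := by
    rintro (_ | _ | p)
    exacts [contDiffOn_const, contDiffOn_const, (hr p p.2).mono Set.inter_subset_left]
  have hmemW : ∀ i x, f i x ≠ 0 → x ∈ W i := fun i x h => hf i (subset_tsupport _ h)
  have hρs : ContDiff ℝ ∞ fun x => ∑ᶠ i, f i x • g i x := by
    rw [← contMDiff_iff_contDiff]
    exact hf.contMDiff_finsum_smul hWo fun i => (contMDiffOn_iff_contDiffOn.2 (hg i))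
  have hneg : ∀ x ∈ Ω, ∑ᶠ i, f i x • g i x < 0 := fun x hx => by
    refine f.finsum_smul_mem_convex (g := g) (t := Set.Iio (0 : ℝ)) (Set.mem_univ x) ?_
      (convex_Iio (0 : ℝ))
    rintro (_ | _ | p) hi
    · simp [g]
    · exact absurd (subset_closure hx) (hmemW _ x hi)
    · exact (hside p p.2 x (hmemW _ x hi).1).1 hx
  have hnonneg : ∀ x, x ∉ Ω → 0 ≤ ∑ᶠ i, f i x • g i x := fun x hx => by
    refine f.finsum_smul_mem_convex (g := g) (t := Set.Ici (0 : ℝ)) (Set.mem_univ x) ?_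
      (convex_Ici (0 : ℝ))
    rintro (_ | _ | p) hi
    · exact absurd (hmemW _ x hi) hx
    · simp [g]
    · exact not_lt.1 fun h => hx ((hside p p.2 x (hmemW _ x hi).1).2 h)
  have hiff : ∀ x, x ∈ Ω ↔ ∑ᶠ i, f i x • g i x < 0 := fun x =>
    ⟨hneg x, fun h => by_contra fun hx => absurd h (not_lt.2 (hnonneg x hx))⟩
  refine ⟨_, hρs, hiff, fun x hx => ⟨eq_zero_of_mem_frontier_of_eventually
    (ρ := fun x => ∑ᶠ i, f i x • g i x) hΩ hx hρs.continuous.continuousAt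
      (Eventually.of_forall hiff), ?_⟩⟩
  -- near the boundary point `x` only local defining functions contribute
  have hloc : ∀ i ∈ f.fintsupport x, ∃ ℓ : E →L[ℝ] ℝ, HasFDerivAt (g i) ℓ x ∧ g i x = 0 ∧ ℓ ≠ 0 ∧
      ∀ᶠ y in 𝓝 x, y ∈ Ω ↔ g i y < 0 := by
    intro i hi
    have hxi : x ∈ W i := hf i ((f.mem_fintsupport_iff x i).1 hi)
    rw [hΩ.frontier_eq] at hx
    match i, hxi with
    | none, hxi => exact absurd hxi hx.2
    | some none, hxi => exact absurd hx.1 hxi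
    | some (some p), hxi =>
      have hnhds := (hUo p p.2).mem_nhds hxi.1
      have hd : DifferentiableAt ℝ (r p) x :=
        ((hr p p.2).contDiffAt hnhds).differentiableAt (by simp)
      have hs : ∀ᶠ y in 𝓝 x, y ∈ Ω ↔ r p y < 0 := by
        filter_upwards [hnhds] with y hy using hside p p.2 y hy
      exact ⟨fderiv ℝ (r p) x, hd.hasFDerivAt, eq_zero_of_mem_frontier_of_eventually hΩ
        (hΩ.frontier_eq ▸ hx) hd.continuousAt hs, hxi.2, hs⟩
  choose! ℓ hℓ h0 hℓ0 hs using hloc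
  have hder : HasFDerivAt (fun x => ∑ᶠ i, f i x • g i x)
      (∑ i ∈ f.fintsupport x, f i x • ℓ i) x := by
    have h1 : HasFDerivAt (fun y => ∑ i ∈ f.fintsupport x, f i y • g i y)
        (∑ i ∈ f.fintsupport x, f i x • ℓ i) x := by
      refine HasFDerivAt.fun_sum fun i hi => ?_
      have h2 : HasFDerivAt (f i) (fderiv ℝ (f i) x) x :=
        ((contMDiff_iff_contDiff.1 (f i).contMDiff).differentiable (by simp) x).hasFDerivAt
      refine (h2.fun_smul (hℓ i hi)).congr_fderiv ?_
      ext w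
      simp [h0 i hi]
    refine h1.congr_of_eventuallyEq ?_
    filter_upwards [f.eventually_finsupport_subset x] with y hy
    rw [← f.sum_finsupport_smul_eq_finsum]
    refine Finset.sum_subset hy fun i _ hi => ?_
    rw [f.mem_finsupport, Function.notMem_support] at hi
    rw [hi, zero_smul]
  obtain ⟨i₀, hi₀⟩ := f.exists_pos_of_mem (Set.mem_univ x)
  have hi₀s : i₀ ∈ f.fintsupport x :=
    f.finsupport_subset_fintsupport x ((f.mem_finsupport x).2 hi₀.ne')
  obtain ⟨w, hw⟩ := exists_apply_neg_of_ne_zero (hℓ0 i₀ hi₀s)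
  rw [hder.fderiv]
  intro hcon
  have h1 : ∀ i ∈ f.fintsupport x, ℓ i w < 0 := fun i hi =>
    apply_neg_of_apply_neg (hℓ i₀ hi₀s) (hℓ i hi) (h0 i₀ hi₀s) (h0 i hi)
      (by filter_upwards [hs i₀ hi₀s, hs i hi] with y h1 h2 using h1.symm.trans h2) (hℓ0 i hi) hw
  have h2 : (∑ i ∈ f.fintsupport x, f i x • ℓ i) w < 0 := by
    rw [sum_apply]
    refine Finset.sum_neg' (fun i hi => ?_) ⟨i₀, hi₀s, ?_⟩
    · exact mul_nonpos_of_nonneg_of_nonpos (f.nonneg i x) (h1 i hi).le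
    · exact mul_neg_of_pos_of_neg hi₀ (h1 i₀ hi₀s)
  simp [hcon] at h2

end DefiningFunction

/-! ### A height-raising flow on the closed domain -/

section GradientLike

variable {V : Type*} [NormedAddCommGroup V] [NormedSpace ℝ V] [FiniteDimensional ℝ V]

/-- The tangent space of the level set of `ρ` through `x` is horizontal (or all of `V × ℝ`):
the height is critical at `x` on this level set. -/
def IsHeightCritical (ρ : V × ℝ → ℝ) (x : V × ℝ) : Prop := ∀ v : V, fderiv ℝ ρ x (v, 0) = 0

/-- The square of the length of the horizontal part of the differential of `ρ`, computed in a fixed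
basis. -/
noncomputable def horizontalNormSq (ρ : V × ℝ → ℝ) (x : V × ℝ) : ℝ :=
  ∑ j, fderiv ℝ ρ x (Module.finBasis ℝ V j, 0) ^ 2

/-- The field `(-ρ_s ∇_z ρ, |∇_z ρ|² - ρ)`. It is tangent to `{ρ = 0}`. On `{ρ ≤ 0}` it
vanishes at the critical points of the height on `{ρ = 0}`, and points upwards elsewhere. -/
noncomputable def ascendingField (ρ : V × ℝ → ℝ) (x : V × ℝ) : V × ℝ :=
  (-(fderiv ℝ ρ x (0, 1)) •
    ∑ j, fderiv ℝ ρ x (Module.finBasis ℝ V j, 0) • Module.finBasis ℝ V j,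
    horizontalNormSq ρ x - ρ x)

variable {ρ : V × ℝ → ℝ} {x : V × ℝ}

theorem horizontalNormSq_nonneg : 0 ≤ horizontalNormSq ρ x :=
  Finset.sum_nonneg fun _ _ => sq_nonneg _

theorem horizontalNormSq_eq_zero : horizontalNormSq ρ x = 0 ↔ IsHeightCritical ρ x := by
  rw [horizontalNormSq, Finset.sum_eq_zero_iff_of_nonneg fun _ _ => sq_nonneg _]
  refine ⟨fun h v => ?_, fun h j _ => by simp [h (Module.finBasis ℝ V j)]⟩
  have : ((fderiv ℝ ρ x : V × ℝ →ₗ[ℝ] ℝ).comp (LinearMap.inl ℝ V ℝ)) = 0 :=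
    (Module.finBasis ℝ V).ext fun j => by simpa using h j (Finset.mem_univ j)
  simpa using LinearMap.congr_fun this v

theorem fderiv_ascendingField :
    fderiv ℝ ρ x (ascendingField ρ x) = -(fderiv ℝ ρ x (0, 1)) * ρ x := by
  have h : ascendingField ρ x = -(fderiv ℝ ρ x (0, 1)) •
      ∑ j, fderiv ℝ ρ x (Module.finBasis ℝ V j, 0) • ((Module.finBasis ℝ V j, 0) : V × ℝ) +
      (horizontalNormSq ρ x - ρ x) • ((0, 1) : V × ℝ) := by
    ext <;> simp [ascendingField, Prod.fst_sum, Prod.snd_sum]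
  rw [h]
  simp only [map_add, map_smul, map_sum, smul_eq_mul, horizontalNormSq, ← pow_two]
  ring

theorem contDiff_ascendingField (hρ : ContDiff ℝ ∞ ρ) : ContDiff ℝ ∞ (ascendingField ρ) := by
  have h : ∀ v, ContDiff ℝ ∞ fun x => fderiv ℝ ρ x v := fun v =>
    (hρ.fderiv_right (m := ∞) (by simp)).clm_apply contDiff_const
  have h1 := h (0, 1)
  have h2 : ∀ j, ContDiff ℝ ∞ fun x => fderiv ℝ ρ x (Module.finBasis ℝ V j, 0) := fun j => h _
  unfold ascendingField horizontalNormSq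
  fun_prop

/-- The closure of a smoothly bounded set carries a flow, preserving the set, along which the height
increases strictly off the critical points of the height on the boundary. -/
theorem exists_ascending_flow {Ω : Set (V × ℝ)} (hρ : ContDiff ℝ ∞ ρ)
    (hΩ : ∀ x, x ∈ Ω ↔ ρ x < 0) (hfr : ∀ x ∈ frontier Ω, ρ x = 0)
    (hb : Bornology.IsBounded Ω) :
    ∃ φ : Flow ℝ (closure Ω), (∀ t x, ((φ t x : closure Ω) : V × ℝ) ∈ Ω ↔ (x : V × ℝ) ∈ Ω) ∧
      IsStrictLyapunov φ (fun x => -(x : V × ℝ).2) ∧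
      ∀ x, IsEquilibrium φ x ↔ (x : V × ℝ) ∈ frontier Ω ∧ IsHeightCritical ρ x := by
  have hΩo : IsOpen Ω := by
    have : Ω = ρ ⁻¹' Set.Iio 0 := Set.ext hΩ
    exact this ▸ isOpen_Iio.preimage hρ.continuous
  obtain ⟨R, hR0, hR⟩ : ∃ R > 0, closure Ω ⊆ Metric.closedBall 0 R := by
    obtain ⟨R, hR⟩ := hb.closure.subset_closedBall 0
    exact ⟨max R 1, by positivity, hR.trans (Metric.closedBall_subset_closedBall (le_max_left _ _))⟩
  -- the cut-off makes the field bounded and Lipschitz without changing it on the closed domain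
  let χ : ContDiffBump (0 : V × ℝ) := ⟨R, R + 1, hR0, by linarith⟩
  let X : V × ℝ → V × ℝ := fun x => χ x • ascendingField ρ x
  have hX : ContDiff ℝ ∞ X := χ.contDiff.smul (contDiff_ascendingField hρ)
  have hXc : HasCompactSupport X := χ.hasCompactSupport.smul_right
  obtain ⟨K, hK⟩ := (hX.of_le (by simp)).lipschitzWith_of_hasCompactSupport hXc one_ne_zero
  obtain ⟨C, hC⟩ := hXc.exists_bound_of_continuous hX.continuous
  obtain ⟨φ, hφ⟩ := exists_flow_of_lipschitzWith_of_norm_le hK (C := C.toNNReal)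
    fun x => (hC x).trans (Real.le_coe_toNNReal C)
  have hsgn : ∀ x t, ∃ c > 0, ρ (φ t x) = ρ x * c := by
    intro x t
    -- `ρ` solves a homogeneous linear equation along the flow
    let k : ℝ → ℝ := fun t => -(χ (φ t x) * fderiv ℝ ρ (φ t x) (0, 1))
    have hφc : Continuous fun t => φ t x := by fun_prop
    have hk : Continuous k := by
      have h1 : Continuous fun y => fderiv ℝ ρ y ((0 : V), (1 : ℝ)) :=
        (hρ.continuous_fderiv (by simp)).clm_apply continuous_const
      exact ((χ.continuous.comp hφc).mul (h1.comp hφc)).neg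
    have hint : ∀ t, HasDerivAt (fun t => ∫ τ in (0 : ℝ)..t, k τ) (k t) t := fun t =>
      intervalIntegral.integral_hasDerivAt_right (hk.intervalIntegrable _ _)
        (hk.stronglyMeasurableAtFilter _ _) hk.continuousAt
    have hd : ∀ t, HasDerivAt (fun t => ρ (φ t x)) (k t * ρ (φ t x)) t := by
      intro t
      have h1 := (hρ.differentiable (by simp) (φ t x)).hasFDerivAt.comp_hasDerivAt t (hφ x t)
      refine h1.congr_deriv ?_
      simp only [X, map_smul, fderiv_ascendingField, smul_eq_mul, k]
      ring
    have hd2 : ∀ t, HasDerivAt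
        (fun t => ρ (φ t x) * Real.exp (-∫ τ in (0 : ℝ)..t, k τ)) 0 t := by
      intro t
      refine ((hd t).mul (hint t).neg.exp).congr_deriv ?_
      ring
    have hconst := is_const_of_deriv_eq_zero (fun t => (hd2 t).differentiableAt)
      (fun t => (hd2 t).deriv) t 0
    refine ⟨Real.exp (∫ τ in (0 : ℝ)..t, k τ), Real.exp_pos _, ?_⟩
    simp only [φ.map_zero_apply, intervalIntegral.integral_same, neg_zero, Real.exp_zero,
      mul_one] at hconst
    rw [← hconst, mul_assoc, ← Real.exp_add, neg_add_cancel, Real.exp_zero, mul_one]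
  have hinv : ∀ x t, φ t x ∈ Ω ↔ x ∈ Ω := by
    intro x t
    obtain ⟨c, hc, h⟩ := hsgn x t
    rw [hΩ, hΩ, h]
    exact ⟨fun h => by by_contra! h'; exact absurd h (not_lt.2 (mul_nonneg h' hc.le)),
      fun h => mul_neg_of_neg_of_pos h hc⟩
  have hcl : IsInvariant φ.toFun (closure Ω) := fun t =>
    Set.MapsTo.closure (fun x hx => (hinv x t).2 hx) (φ.continuous_toFun t)
  have hXeq : ∀ x ∈ closure Ω, X x = ascendingField ρ x := fun x hx => by
    have : χ x = 1 := χ.one_of_mem_closedBall (hR hx)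
    simp [X, this]
  have hρle : ∀ x ∈ closure Ω, ρ x ≤ 0 := fun x hx => by
    by_cases h : x ∈ Ω
    · exact ((hΩ x).1 h).le
    · exact (hfr x (hΩo.frontier_eq ▸ ⟨hx, h⟩)).le
  have heq : ∀ x, X x = 0 → ∀ t, φ t x = x := by
    intro x hx
    refine congrFun (ODE_solution_unique_univ (v := fun _ => X) (s := fun _ => Set.univ) (t₀ := 0)
      (K := K) (f := fun t => φ t x) (g := fun _ => x) (fun _ => hK.lipschitzOnWith)
      (fun t => ⟨hφ x t, trivial⟩) (fun t => ⟨by simpa [hx] using hasDerivAt_const t x, trivial⟩)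
      (φ.map_zero_apply x))
  have hzero : ∀ x ∈ closure Ω, (X x).2 ≤ 0 → x ∈ frontier Ω ∧ IsHeightCritical ρ x := by
    intro x hx h
    rw [hXeq x hx] at h
    have h1 := hρle x hx
    have h2 : 0 ≤ horizontalNormSq ρ x := horizontalNormSq_nonneg
    simp only [ascendingField] at h
    refine ⟨hΩo.frontier_eq ▸ ⟨hx, fun h' => ?_⟩, horizontalNormSq_eq_zero.1 (by linarith)⟩
    linarith [(hΩ x).1 h']
  have hcrit : ∀ x ∈ frontier Ω, IsHeightCritical ρ x → X x = 0 := by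
    intro x hx hc
    rw [hXeq x hx.1, ascendingField, horizontalNormSq_eq_zero.2 hc, hfr x hx]
    simp [hc _]
  refine ⟨φ.restrict hcl, fun t x => by simp [hinv], ⟨by fun_prop, ?_⟩, fun x => ⟨fun h => ?_,
    fun h t => Subtype.ext (by simpa using heq x (hcrit x h.1 h.2) t)⟩⟩
  · intro x hx t ht
    have hder : ∀ t, HasDerivAt (fun t => (φ t x).2) (X (φ t x)).2 t := fun t => (hφ x t).snd
    have hpos : ∀ t, 0 < (X (φ t x)).2 := by
      intro t
      by_contra! hle
      have h1 := hzero _ (hcl t x.2) hle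
      have h2 := heq _ (hcrit _ h1.1 h1.2)
      refine hx (IsEquilibrium.of_apply (t := t) fun τ => Subtype.ext ?_)
      simpa using h2 τ
    have hmono : StrictMono fun t => (φ t x).2 :=
      strictMono_of_deriv_pos fun t => by rw [(hder t).deriv]; exact hpos t
    have := hmono ht
    simpa using this
  · refine hzero x x.2 (le_of_eq ?_)
    have h1 : ∀ t, φ t x = x := fun t => by simpa using congrArg Subtype.val (h t)
    have h2 := hφ x 0
    simp only [h1] at h2
    rw [h2.unique (hasDerivAt_const 0 _), Prod.snd_zero]

end GradientLike

/-! ### CR singular points as critical points of the height -/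

section TangentSpace

theorem mem_frontier_of_eq_zero {E : Type*} [NormedAddCommGroup E] [NormedSpace ℝ E] {Ω : Set E}
    {ρ : E → ℝ} (hΩ : ∀ x, x ∈ Ω ↔ ρ x < 0) {x : E} (h0 : ρ x = 0) (hd : fderiv ℝ ρ x ≠ 0) :
    x ∈ frontier Ω := by
  have hdiff : DifferentiableAt ℝ ρ x := by
    by_contra h
    exact hd (fderiv_zero_of_not_differentiableAt h)
  obtain ⟨w, hw⟩ := exists_apply_neg_of_ne_zero hd
  refine ⟨mem_closure_of_tendsto (tendsto_add_smul_nhdsGT x w) ?_, fun h => ?_⟩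
  · filter_upwards [hdiff.hasFDerivAt.eventually_neg_of_apply_neg h0 hw] with t ht using (hΩ _).2 ht
  · exact absurd ((hΩ x).1 (interior_subset h)) (by simp [h0])

/-- Every vector in the kernel of the differential of a defining function is the velocity of a
smooth curve in the boundary: take an integral curve of a field along which the defining function
is constant. -/
theorem exists_curve_mem_frontier {E : Type*} [NormedAddCommGroup E] [NormedSpace ℝ E]
    [CompleteSpace E] {Ω : Set E} {ρ : E → ℝ} (hρ : ContDiff ℝ ∞ ρ) (hΩ : ∀ x, x ∈ Ω ↔ ρ x < 0)
    {x v : E} (h0 : ρ x = 0) (hd : fderiv ℝ ρ x ≠ 0) (hv : fderiv ℝ ρ x v = 0) :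
    ∃ (ε : ℝ) (γ : ℝ → E), 0 < ε ∧ ContDiffOn ℝ ∞ γ (Set.Ioo (-ε) ε) ∧
      (∀ t ∈ Set.Ioo (-ε) ε, γ t ∈ frontier Ω) ∧ γ 0 = x ∧ HasDerivAt γ v 0 := by
  obtain ⟨w, hw⟩ : ∃ w, fderiv ℝ ρ x w = 1 := by
    obtain ⟨w, hw⟩ := exists_apply_neg_of_ne_zero hd
    exact ⟨(fderiv ℝ ρ x w)⁻¹ • w, by simp [hw.ne]⟩
  let Y : E → E := fun y => fderiv ℝ ρ y w • v - fderiv ℝ ρ y v • w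
  have h : ∀ v, ContDiff ℝ ∞ fun x => fderiv ℝ ρ x v := fun v =>
    (hρ.fderiv_right (m := ∞) (by simp)).clm_apply contDiff_const
  have hY : ContDiff ℝ ∞ Y := ((h w).smul contDiff_const).sub ((h v).smul contDiff_const)
  obtain ⟨γ, hγ0, ε, hε, hγ⟩ := (hY.contDiffAt (x := x)).of_le
    (by simp : (1 : WithTop ℕ∞) ≤ ∞)
    |>.exists_forall_mem_closedBall_exists_eq_forall_mem_Ioo_hasDerivAt₀ 0
  simp only [zero_sub, zero_add] at hγ
  have hmem0 : (0 : ℝ) ∈ Set.Ioo (-ε) ε := ⟨by linarith, hε⟩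
  have hconst : ∀ t ∈ Set.Ioo (-ε) ε, ρ (γ t) = 0 := by
    intro t ht
    have hder : ∀ t ∈ Set.Ioo (-ε) ε, HasDerivAt (fun t => ρ (γ t)) 0 t := fun t ht => by
      have := (hρ.differentiable (by simp) (γ t)).hasFDerivAt.comp_hasDerivAt t (hγ t ht)
      refine this.congr_deriv ?_
      simp only [Y, map_sub, map_smul, smul_eq_mul]
      ring
    rw [← h0, ← hγ0]
    exact isOpen_Ioo.is_const_of_deriv_eq_zero isPreconnected_Ioo
      (fun t ht => (hder t ht).differentiableAt.differentiableWithinAt)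
      (fun t ht => (hder t ht).deriv) ht hmem0
  have hne : ∀ᶠ t in 𝓝 (0 : ℝ), fderiv ℝ ρ (γ t) ≠ 0 := by
    have h1 : ContinuousAt (fun t => fderiv ℝ ρ (γ t)) 0 :=
      (hρ.continuous_fderiv (by simp)).continuousAt.comp (hγ 0 hmem0).continuousAt
    exact h1.eventually_ne (by rwa [hγ0])
  obtain ⟨δ, hδ, hδne⟩ := Metric.eventually_nhds_iff_ball.1 hne
  have hsub : Set.Icc (-(ε / 2)) (ε / 2) ⊆ Set.Ioo (-ε) ε :=
    Set.Icc_subset_Ioo (by linarith) (by linarith)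
  have hs : ContDiffOn ℝ ∞ γ (Set.Icc (-(ε / 2)) (ε / 2)) :=
    ODE.contDiffOn_enat_Icc_of_hasDerivWithinAt (f := fun _ => Y) (u := Set.univ) (n := ⊤)
      (hY.comp contDiff_snd).contDiffOn (fun t ht => (hγ t (hsub ht)).hasDerivWithinAt)
      (fun _ _ => trivial)
  refine ⟨min (ε / 2) δ, γ, lt_min (by linarith) hδ, hs.mono ?_, fun t ht => ?_, hγ0, ?_⟩
  · exact Set.Ioo_subset_Icc_self.trans
      (Set.Icc_subset_Icc (neg_le_neg (min_le_left _ _)) (min_le_left _ _))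
  · have ht' := abs_lt.2 ht
    refine mem_frontier_of_eq_zero hΩ (hconst t (abs_lt.1 ?_)) (hδne t ?_)
    · linarith [min_le_left (ε / 2) δ]
    · simpa using ht'.trans_le (min_le_right _ _)
  · refine (hγ 0 hmem0).congr_deriv ?_
    simp [Y, hγ0, hw, hv]

variable {n : ℕ} {Ω : Set (EuclideanSpace ℂ (Fin n) × ℝ)} {ρ : EuclideanSpace ℂ (Fin n) × ℝ → ℝ}
  {x : EuclideanSpace ℂ (Fin n) × ℝ}

/-- The inclusion `flatInclusion` as a real linear map. -/
noncomputable def flatInclusionL (n : ℕ) :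
    EuclideanSpace ℂ (Fin n) × ℝ →L[ℝ] EuclideanSpace ℂ (Fin n) × ℂ :=
  (ContinuousLinearMap.id ℝ _).prodMap Complex.ofRealCLM

theorem flatInclusion_injective : Function.Injective (flatInclusion n) := fun a b h => by
  simpa [flatInclusion, Prod.ext_iff] using h

theorem isEmbedding_flatInclusion : IsEmbedding (flatInclusion n) :=
  IsEmbedding.id.prodMap Complex.isometry_ofReal.isEmbedding

theorem realTangentSpace_boundaryInCn (hρ : ContDiff ℝ ∞ ρ) (hΩ : ∀ x, x ∈ Ω ↔ ρ x < 0)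
    (hfr : ∀ x ∈ frontier Ω, ρ x = 0 ∧ fderiv ℝ ρ x ≠ 0) (hx : x ∈ frontier Ω) :
    realTangentSpace (boundaryInCn Ω) (flatInclusion n x) =
      (LinearMap.ker (fderiv ℝ ρ x : EuclideanSpace ℂ (Fin n) × ℝ →ₗ[ℝ] ℝ)).map
        (flatInclusionL n : EuclideanSpace ℂ (Fin n) × ℝ →ₗ[ℝ] EuclideanSpace ℂ (Fin n) × ℂ) := by
  refine le_antisymm (Submodule.span_le.2 ?_) ?_
  · rintro v ⟨ε, γ, hε, -, hγM, hγ0, hγ⟩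
    have hmem : ∀ᶠ t in 𝓝 (0 : ℝ), γ t ∈ boundaryInCn Ω := by
      filter_upwards [Ioo_mem_nhds (neg_lt_zero.2 hε) hε] with t ht using hγM t ht
    let R : EuclideanSpace ℂ (Fin n) × ℂ →L[ℝ] EuclideanSpace ℂ (Fin n) × ℝ :=
      (ContinuousLinearMap.id ℝ _).prodMap Complex.reCLM
    have hR : ∀ y, R (flatInclusion n y) = y := fun y => by simp [R, flatInclusion]
    have h1 : HasDerivAt (fun t => R (γ t)) (R v) 0 := R.hasFDerivAt.comp_hasDerivAt 0 hγ
    have h2 : HasDerivAt (fun t => ρ (R (γ t))) (fderiv ℝ ρ x (R v)) 0 := by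
      have h3 : HasFDerivAt ρ (fderiv ℝ ρ x) (R (γ 0)) := by
        rw [hγ0, hR]
        exact (hρ.differentiable (by simp) x).hasFDerivAt
      exact h3.comp_hasDerivAt 0 h1
    have h3 : (fun t => ρ (R (γ t))) =ᶠ[𝓝 0] fun _ => 0 := by
      filter_upwards [hmem] with t ht
      obtain ⟨y, hy, hyt⟩ := ht
      rw [← hyt, hR, (hfr y hy).1]
    have h4 : HasDerivAt (fun t => (γ t).2.im) v.2.im 0 :=
      Complex.imCLM.hasFDerivAt.comp_hasDerivAt 0 hγ.snd
    have h5 : (fun t => (γ t).2.im) =ᶠ[𝓝 0] fun _ => 0 := by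
      filter_upwards [hmem] with t ht
      obtain ⟨y, hy, hyt⟩ := ht
      simp [← hyt, flatInclusion]
    refine ⟨R v, h2.unique ((hasDerivAt_const 0 (0 : ℝ)).congr_of_eventuallyEq h3), ?_⟩
    have h6 := h4.unique ((hasDerivAt_const 0 (0 : ℝ)).congr_of_eventuallyEq h5)
    refine Prod.ext (by simp [R, flatInclusionL]) (Complex.ext ?_ ?_)
    · simp [R, flatInclusionL]
    · simp [R, flatInclusionL, h6]
  · rintro _ ⟨v, hv, rfl⟩
    obtain ⟨ε, γ, hε, hs, hM, h0, hd⟩ :=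
      exists_curve_mem_frontier hρ hΩ (hfr x hx).1 (hfr x hx).2 hv
    refine Submodule.subset_span ⟨ε, fun t => flatInclusionL n (γ t), hε,
      (flatInclusionL n).contDiff.comp_contDiffOn hs, fun t ht => ⟨γ t, hM t ht, rfl⟩, ?_, ?_⟩
    · simp only [h0]
      rfl
    · exact (flatInclusionL n).hasFDerivAt.comp_hasDerivAt 0 hd

/-- The horizontal part of a real functional on `V × ℝ`, made complex linear. For the
differential of a defining function, its kernel is the complex tangent space. -/
noncomputable def complexHorizontalPart (ℓ : EuclideanSpace ℂ (Fin n) × ℝ →L[ℝ] ℝ) :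
    Module.Dual ℂ (EuclideanSpace ℂ (Fin n)) :=
  Module.Dual.extendRCLike (𝕜 := ℂ) ((ℓ : _ →ₗ[ℝ] ℝ).comp (LinearMap.inl ℝ _ ℝ))

theorem mem_ker_complexHorizontalPart {ℓ : EuclideanSpace ℂ (Fin n) × ℝ →L[ℝ] ℝ}
    {v : EuclideanSpace ℂ (Fin n)} :
    v ∈ LinearMap.ker (complexHorizontalPart ℓ) ↔ ℓ (v, 0) = 0 ∧ ℓ (Complex.I • v, 0) = 0 := by
  simp [complexHorizontalPart, Module.Dual.extendRCLike_apply, Complex.ext_iff]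

theorem complexHorizontalPart_eq_zero :
    complexHorizontalPart (fderiv ℝ ρ x) = 0 ↔ IsHeightCritical ρ x := by
  refine ⟨fun h v => ?_, fun h => LinearMap.ext fun v => ?_⟩
  · exact (mem_ker_complexHorizontalPart.1 (LinearMap.congr_fun h v)).1
  · exact mem_ker_complexHorizontalPart.2 ⟨h v, h _⟩

theorem finrank_complexTangentSpace (hρ : ContDiff ℝ ∞ ρ) (hΩ : ∀ x, x ∈ Ω ↔ ρ x < 0)
    (hfr : ∀ x ∈ frontier Ω, ρ x = 0 ∧ fderiv ℝ ρ x ≠ 0) (hx : x ∈ frontier Ω) :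
    Module.finrank ℝ (complexTangentSpace (boundaryInCn Ω) (flatInclusion n x)) =
      2 * Module.finrank ℂ (LinearMap.ker (complexHorizontalPart (fderiv ℝ ρ x))) := by
  rw [← finrank_real_of_complex]
  have h : complexTangentSpace (boundaryInCn Ω) (flatInclusion n x) =
      ((LinearMap.ker (complexHorizontalPart (fderiv ℝ ρ x))).restrictScalars ℝ).map
        (LinearMap.inl ℝ (EuclideanSpace ℂ (Fin n)) ℂ) := by
    rw [complexTangentSpace, realTangentSpace_boundaryInCn hρ hΩ hfr hx]
    ext y
    constructor
    · rintro ⟨⟨_, ⟨⟨v, τ⟩, hv, rfl⟩, rfl⟩, ⟨⟨v', τ'⟩, hv', h⟩⟩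
      have h1 : v' = Complex.I • v := congrArg Prod.fst h
      have h2 : (τ' : ℂ) = Complex.I * τ := congrArg Prod.snd h
      have h3 : τ = 0 := by simpa using (congrArg Complex.im h2).symm
      have h4 : τ' = 0 := by simpa using congrArg Complex.re h2
      subst h1 h3 h4
      refine ⟨Complex.I • v, mem_ker_complexHorizontalPart.2 ⟨hv', ?_⟩, ?_⟩
      · have h5 : (Complex.I • Complex.I • v, (0 : ℝ)) = -(v, 0) := by simp [smul_smul]
        rw [h5, map_neg, neg_eq_zero]
        exact hv
      · simp [complexStructure, flatInclusionL]
    · rintro ⟨v, hv, rfl⟩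
      obtain ⟨h1, h2⟩ := mem_ker_complexHorizontalPart.1 hv
      refine ⟨⟨(-(Complex.I • v), 0), ⟨(-(Complex.I • v), 0), ?_, by simp [flatInclusionL]⟩, ?_⟩,
        ⟨(v, 0), h1, by simp [flatInclusionL]⟩⟩
      · change fderiv ℝ ρ x (-(Complex.I • v), 0) = 0
        rw [← neg_zero (G := ℝ), ← Prod.neg_mk, map_neg, h2, neg_zero]
      · simp [complexStructure, smul_smul]
  rw [h]
  exact (Submodule.equivMapOfInjective _ LinearMap.inl_injective _).finrank_eq.symm

/-- The CR singular points of the boundary are the critical points of the height which are not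
interior to the set of critical points. -/
theorem flatInclusion_mem_crSingularSet (hρ : ContDiff ℝ ∞ ρ)
    (hΩ : ∀ x, x ∈ Ω ↔ ρ x < 0) (hfr : ∀ x ∈ frontier Ω, ρ x = 0 ∧ fderiv ℝ ρ x ≠ 0)
    (hx : x ∈ frontier Ω) :
    flatInclusion n x ∈ crSingularSet (boundaryInCn Ω) ↔
      IsHeightCritical ρ x ∧ ¬ ∀ᶠ y in 𝓝[frontier Ω] x, IsHeightCritical ρ y := by
  have hcr : IsCRAt (boundaryInCn Ω) (flatInclusion n x) ↔ ∀ᶠ y in 𝓝[frontier Ω] x,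
      (IsHeightCritical ρ y ↔ IsHeightCritical ρ x) := by
    rw [IsCRAt, boundaryInCn, ← isEmbedding_flatInclusion.map_nhdsWithin_eq, eventually_map]
    refine eventually_congr ?_
    filter_upwards [self_mem_nhdsWithin] with y hy
    change Module.finrank ℝ (complexTangentSpace (boundaryInCn Ω) (flatInclusion n y)) =
      Module.finrank ℝ (complexTangentSpace (boundaryInCn Ω) (flatInclusion n x)) ↔ _
    rw [finrank_complexTangentSpace hρ hΩ hfr hy, finrank_complexTangentSpace hρ hΩ hfr hx,
      ← complexHorizontalPart_eq_zero, ← complexHorizontalPart_eq_zero]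
    have hker : ∀ f : Module.Dual ℂ (EuclideanSpace ℂ (Fin n)), (f = 0 ∧
        Module.finrank ℂ (LinearMap.ker f) = n) ∨
        (f ≠ 0 ∧ Module.finrank ℂ (LinearMap.ker f) + 1 = n) := by
      intro f
      by_cases hf : f = 0
      · exact Or.inl ⟨hf, by rw [hf, LinearMap.ker_zero, finrank_top, finrank_euclideanSpace_fin]⟩
      · exact Or.inr ⟨hf, by simpa using Module.Dual.finrank_ker_add_one_of_ne_zero hf⟩
    rcases hker (complexHorizontalPart (fderiv ℝ ρ y)) with h1 | h1 <;>
      rcases hker (complexHorizontalPart (fderiv ℝ ρ x)) with h2 | h2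
    · exact iff_of_true (by omega) (iff_of_true h1.1 h2.1)
    · exact iff_of_false (by omega) fun h => h2.1 (h.1 h1.1)
    · exact iff_of_false (by omega) fun h => h1.1 (h.2 h2.1)
    · exact iff_of_true (by omega) (iff_of_false h1.1 h2.1)
  have hmem : flatInclusion n x ∈ boundaryInCn Ω := ⟨x, hx, rfl⟩
  change (_ ∧ _) ↔ _
  rw [and_iff_right hmem, hcr]
  by_cases hc : IsHeightCritical ρ x
  · simp [hc]
  · simp only [hc, iff_false, false_and, not_not]
    -- not being critical is an open condition
    obtain ⟨v, hv⟩ := not_forall.1 hc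
    have hcont : Continuous fun y => fderiv ℝ ρ y (v, (0 : ℝ)) :=
      (hρ.continuous_fderiv (by simp)).clm_apply continuous_const
    exact ((hcont.continuousAt.eventually_ne hv).filter_mono nhdsWithin_le_nhds).mono
      fun y hy h => hy (h v)

end TangentSpace

/-! ### Elliptic points and the set of critical points -/

section EllipticPoint

variable {V : Type*} [NormedAddCommGroup V] [NormedSpace ℝ V]

/-- `h` vanishes at `0` and increases strictly along the rays from `0` in the ball of radius `r`. -/
structure IsRadiallyIncreasing (h : V → ℝ) (r : ℝ) : Prop where
  zero : h 0 = 0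
  differentiableAt : ∀ w ∈ Metric.ball 0 r, DifferentiableAt ℝ h w
  pos : ∀ w ∈ Metric.ball 0 r, w ≠ 0 → 0 < fderiv ℝ h w w

theorem IsRadiallyIncreasing.strictMonoOn {h : V → ℝ} {r : ℝ} (hh : IsRadiallyIncreasing h r)
    {w : V} (hw : w ∈ Metric.ball 0 r) (h0 : w ≠ 0) :
    StrictMonoOn (fun t : ℝ => h (t • w)) (Set.Icc 0 1) := by
  have hball : ∀ t ∈ Set.Icc (0 : ℝ) 1, t • w ∈ Metric.ball 0 r := fun t ht => by
    rw [mem_ball_zero_iff] at hw ⊢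
    rw [norm_smul, Real.norm_of_nonneg ht.1]
    exact (mul_le_of_le_one_left (norm_nonneg w) ht.2).trans_lt hw
  have hder : ∀ t ∈ Set.Icc (0 : ℝ) 1, HasDerivAt (fun t : ℝ => h (t • w))
      (fderiv ℝ h (t • w) w) t := fun t ht => by
    have h2 : HasDerivAt (fun t : ℝ => t • w) w t := by
      simpa using (hasDerivAt_id t).smul_const w
    exact (hh.differentiableAt _ (hball t ht)).hasFDerivAt.comp_hasDerivAt t h2
  refine strictMonoOn_of_deriv_pos (convex_Icc 0 1)
    (fun t ht => (hder t ht).continuousAt.continuousWithinAt) fun t ht => ?_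
  rw [interior_Icc] at ht
  have ht' := Set.Ioo_subset_Icc_self ht
  rw [(hder t ht').deriv]
  have h1 := hh.pos _ (hball t ht') (smul_ne_zero ht.1.ne' h0)
  rw [map_smul, smul_eq_mul] at h1
  exact pos_of_mul_pos_right h1 ht.1.le

theorem IsRadiallyIncreasing.apply_pos {h : V → ℝ} {r : ℝ} (hh : IsRadiallyIncreasing h r)
    {w : V} (hw : w ∈ Metric.ball 0 r) (h0 : w ≠ 0) : 0 < h w := by
  simpa [hh.zero] using hh.strictMonoOn hw h0 (Set.left_mem_Icc.2 zero_le_one)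
    (Set.right_mem_Icc.2 zero_le_one) one_pos

/-- Near `x`, the set `Ω` is the side `σ (s - s₀) > h (z - z₀)` of the graph of a radially
increasing function. -/
structure IsEllipticPoint (Ω : Set (V × ℝ)) (x : V × ℝ) (σ : ℝ) (h : V → ℝ) (r : ℝ) : Prop where
  sign : σ = 1 ∨ σ = -1
  radius_pos : 0 < r
  radial : IsRadiallyIncreasing h r
  side : ∀ᶠ y in 𝓝 x, y ∈ Ω ↔ h (y.1 - x.1) - σ * (y.2 - x.2) < 0

theorem le_zero_of_mem_closure_of_eventually {E : Type*} [TopologicalSpace E] {Ω : Set E} {x : E}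
    {ρ : E → ℝ} (hx : x ∈ closure Ω) (hc : ContinuousAt ρ x)
    (hρ : ∀ᶠ y in 𝓝 x, y ∈ Ω ↔ ρ y < 0) : ρ x ≤ 0 := by
  by_contra! h
  obtain ⟨y, hy, h1, h2⟩ := ((mem_closure_iff_frequently.1 hx).and_eventually
    (hρ.and (hc.eventually (lt_mem_nhds h)))).exists
  exact lt_asymm h2 (h1.1 hy)

variable {Ω : Set (V × ℝ)} {x : V × ℝ} {σ : ℝ} {h : V → ℝ} {r : ℝ}

namespace IsEllipticPoint

theorem eventually_mem_ball (hx : IsEllipticPoint Ω x σ h r) :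
    ∀ᶠ y in 𝓝 x, y.1 - x.1 ∈ Metric.ball 0 r := by
  have : ContinuousAt (fun y : V × ℝ => y.1 - x.1) x := by fun_prop
  exact this.eventually_mem (Metric.isOpen_ball.mem_nhds (by simpa using hx.radius_pos))

theorem hasFDerivAt (hx : IsEllipticPoint Ω x σ h r) {y : V × ℝ}
    (hy : y.1 - x.1 ∈ Metric.ball 0 r) :
    HasFDerivAt (fun y : V × ℝ => h (y.1 - x.1) - σ * (y.2 - x.2))
      ((fderiv ℝ h (y.1 - x.1)).comp (ContinuousLinearMap.fst ℝ V ℝ) -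
        σ • ContinuousLinearMap.snd ℝ V ℝ) y := by
  have h1 : HasFDerivAt (fun y : V × ℝ => y.1 - x.1) (ContinuousLinearMap.fst ℝ V ℝ) y :=
    hasFDerivAt_fst.sub_const x.1
  have h2 : HasFDerivAt (fun y : V × ℝ => σ * (y.2 - x.2)) (σ • ContinuousLinearMap.snd ℝ V ℝ) y :=
    (hasFDerivAt_snd.sub_const x.2).const_mul σ
  exact ((hx.radial.differentiableAt _ hy).hasFDerivAt.comp y h1).sub h2

/-- At an elliptic point the height has a strict local extremum on the closed domain. -/
theorem eventually_lt (hx : IsEllipticPoint Ω x σ h r) :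
    ∀ᶠ y in 𝓝[≠] x, y ∈ closure Ω → 0 < σ * (y.2 - x.2) := by
  rw [eventually_nhdsWithin_iff]
  filter_upwards [hx.eventually_mem_ball, hx.side.eventually_nhds] with y hy hs hne hyc
  have h1 := le_zero_of_mem_closure_of_eventually hyc (hx.hasFDerivAt hy).continuousAt hs
  rcases eq_or_ne y.1 x.1 with heq | hne1
  · have h2 : y.2 - x.2 ≠ 0 := sub_ne_zero.2 fun h2 => hne (Prod.ext heq h2)
    have h3 : σ ≠ 0 := by rcases hx.sign with h | h <;> simp [h]
    rw [heq, sub_self, hx.radial.zero] at h1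
    exact lt_of_le_of_ne (by linarith) (mul_ne_zero h3 h2).symm
  · linarith [hx.radial.apply_pos hy (sub_ne_zero.2 hne1)]

/-- An elliptic point is isolated among the critical points of the height on the boundary. -/
theorem eventually_not_isHeightCritical (hx : IsEllipticPoint Ω x σ h r) {ρ : V × ℝ → ℝ}
    (hρ : ContDiff ℝ ∞ ρ) (hΩ : ∀ x, x ∈ Ω ↔ ρ x < 0)
    (hfr : ∀ x ∈ frontier Ω, ρ x = 0 ∧ fderiv ℝ ρ x ≠ 0) :
    ∀ᶠ y in 𝓝[≠] x, y ∈ frontier Ω → ¬ IsHeightCritical ρ y := by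
  have hΩo : IsOpen Ω := by
    have : Ω = ρ ⁻¹' Set.Iio 0 := Set.ext hΩ
    exact this ▸ isOpen_Iio.preimage hρ.continuous
  rw [eventually_nhdsWithin_iff]
  filter_upwards [hx.eventually_mem_ball, hx.side.eventually_nhds] with y hy hs hne hyf hc
  have h0 := eq_zero_of_mem_frontier_of_eventually hΩo hyf (hx.hasFDerivAt hy).continuousAt hs
  have hne1 : y.1 - x.1 ≠ 0 := by
    intro heq
    have h3 : σ ≠ 0 := by rcases hx.sign with h | h <;> simp [h]
    simp only [heq, hx.radial.zero, zero_sub, neg_eq_zero, mul_eq_zero, h3, false_or] at h0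
    exact hne (Prod.ext (sub_eq_zero.1 heq) (sub_eq_zero.1 h0))
  have h1 := apply_eq_zero_of_apply_eq_zero (v := (y.1 - x.1, 0))
    (hρ.differentiable (by simp) y).hasFDerivAt (hx.hasFDerivAt hy) (hfr y hyf).1 h0
    (hs.mono fun z hz hzn => hz.1 ((hΩ z).2 hzn)) (hfr y hyf).2 (hc _)
  simp only [sub_apply, ContinuousLinearMap.comp_apply,
    ContinuousLinearMap.coe_fst', smul_apply, ContinuousLinearMap.coe_snd',
    smul_zero, sub_zero] at h1
  exact (hx.radial.pos _ hy hne1).ne' h1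

end IsEllipticPoint

/-- If every critical point of the height on the boundary which is not interior to the critical set
is isolated, then the critical set has no interior: this interior would be compact and open in the
boundary, with horizontal tangent spaces, so that no horizontal linear functional could have a
maximum on it. -/
theorem not_eventually_isHeightCritical [FiniteDimensional ℝ V] [Nontrivial V] {ρ : V × ℝ → ℝ}
    (hρ : ContDiff ℝ ∞ ρ) (hΩ : ∀ x, x ∈ Ω ↔ ρ x < 0)
    (hfr : ∀ x ∈ frontier Ω, ρ x = 0 ∧ fderiv ℝ ρ x ≠ 0) (hb : Bornology.IsBounded Ω)
    (hiso : ∀ x ∈ frontier Ω, IsHeightCritical ρ x →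
      (¬ ∀ᶠ y in 𝓝[frontier Ω] x, IsHeightCritical ρ y) →
      ∀ᶠ y in 𝓝[≠] x, y ∈ frontier Ω → ¬ IsHeightCritical ρ y)
    (x : V × ℝ) (hx : x ∈ frontier Ω) : ¬ ∀ᶠ y in 𝓝[frontier Ω] x, IsHeightCritical ρ y := by
  intro hxI
  let I : Set (V × ℝ) := {x | x ∈ frontier Ω ∧ ∀ᶠ y in 𝓝[frontier Ω] x, IsHeightCritical ρ y}
  have hcrit : ∀ y ∈ I, IsHeightCritical ρ y := fun y hy => hy.2.self_of_nhdsWithin hy.1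
  have hclosed : IsClosed {y | IsHeightCritical ρ y} := by
    have : {y | IsHeightCritical ρ y} = ⋂ v : V, {y | fderiv ℝ ρ y (v, 0) = 0} := by
      ext; simp [IsHeightCritical]
    rw [this]
    exact isClosed_iInter fun v => isClosed_eq
      ((hρ.continuous_fderiv (by simp)).clm_apply continuous_const) continuous_const
  have hIc : IsClosed I := by
    refine isClosed_of_closure_subset fun y hy => ?_
    have hyf : y ∈ frontier Ω := closure_minimal (fun _ h => h.1) isClosed_frontier hy
    refine ⟨hyf, by_contra fun hne => ?_⟩
    have h1 := hiso y hyf (closure_minimal hcrit hclosed hy) hne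
    obtain ⟨z, hz, h2⟩ := ((mem_closure_iff_frequently.1 hy).and_eventually
      (eventually_nhdsWithin_iff.1 h1)).exists
    rcases eq_or_ne z y with rfl | hzy
    · exact hne hz.2
    · exact h2 hzy hz.1 (hcrit z hz)
  have hIcomp : IsCompact I := Metric.isCompact_of_isClosed_isBounded hIc
    (hb.closure.subset fun y hy => hy.1.1)
  obtain ⟨u, hu⟩ := exists_ne (0 : V)
  obtain ⟨l, -, hl⟩ := exists_dual_vector ℝ u (norm_ne_zero_iff.2 hu)
  have hlu : l u ≠ 0 := by
    rw [hl]
    simpa using hu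
  obtain ⟨y, hy, hmax⟩ := hIcomp.exists_isMaxOn ⟨x, hx, hxI⟩
    (f := fun y => l y.1) (by fun_prop)
  obtain ⟨ε, γ, hε, -, hγf, hγ0, hγ⟩ := exists_curve_mem_frontier (v := (u, 0)) hρ hΩ
    (hfr y hy.1).1 (hfr y hy.1).2 (hcrit y hy u)
  have hγI : ∀ᶠ t in 𝓝 (0 : ℝ), γ t ∈ I := by
    have hI : ∀ᶠ z in 𝓝[frontier Ω] y, z ∈ I := by
      filter_upwards [eventually_eventually_nhdsWithin.2 hy.2, self_mem_nhdsWithin]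
        with z h1 h2 using ⟨h2, h1⟩
    have h1 : Tendsto γ (𝓝 0) (𝓝[frontier Ω] y) := by
      refine tendsto_nhdsWithin_iff.2 ⟨hγ0 ▸ hγ.continuousAt.tendsto, ?_⟩
      filter_upwards [Ioo_mem_nhds (neg_lt_zero.2 hε) hε] with t ht using hγf t ht
    exact h1.eventually hI
  have hloc : IsLocalMax (fun t => l (γ t).1) 0 := by
    filter_upwards [hγI] with t ht
    rw [hγ0]
    exact hmax ht
  have hd : HasDerivAt (fun t => l (γ t).1) (l u) 0 := l.hasFDerivAt.comp_hasDerivAt 0 hγ.fst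
  exact hlu (hloc.hasDerivAt_eq_zero hd)

end EllipticPoint

/-! ### Perturbations of third order -/

section Cubic

variable {V : Type*} [NormedAddCommGroup V] [NormedSpace ℝ V]

/-- The radial derivative of a smooth function which vanishes to third order is small compared with
the square of the distance: the second derivative vanishes on the diagonal, by l'Hôpital's rule. -/
theorem isLittleO_fderiv_apply_self_of_isBigO_cube {E : V → ℝ} (hE : ContDiffAt ℝ ∞ E 0)
    (hO : E =O[𝓝 0] fun z => ‖z‖ ^ 3) :
    (fun w => fderiv ℝ E w w) =o[𝓝 0] fun w => ‖w‖ ^ 2 := by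
  have hE0 : E 0 = 0 := hO.eq_zero_imp.self_of_nhds (by simp)
  have hD0 : fderiv ℝ E 0 = 0 := by
    have h1 : (fun z : V => ‖z‖ ^ 3) =o[𝓝 0] fun z => z := by
      simpa using Asymptotics.isLittleO_norm_pow_id (E' := V) (n := 3) (by norm_num)
    have h2 : HasFDerivAt E (0 : V →L[ℝ] ℝ) 0 := by
      rw [hasFDerivAt_iff_isLittleO_nhds_zero]
      simpa [hE0] using hO.trans_isLittleO h1
    exact h2.fderiv
  obtain ⟨D2, hD2⟩ : DifferentiableAt ℝ (fderiv ℝ E) 0 :=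
    (hE.fderiv_right (m := ∞) (by simp)).differentiableAt (by simp)
  have hlin : (fun w => fderiv ℝ E w - D2 w) =o[𝓝 0] fun w => w := by
    simpa [hD0] using hasFDerivAt_iff_isLittleO_nhds_zero.1 hD2
  have hdiag : ∀ v, D2 v v = 0 := by
    intro v
    have hline : Tendsto (fun t : ℝ => t • v) (𝓝[>] 0) (𝓝 0) := by
      simpa using tendsto_add_smul_nhdsGT 0 v
    have hdiff : ∀ᶠ w in 𝓝 (0 : V), DifferentiableAt ℝ E w :=
      (hE.of_le (by simp : (1 : WithTop ℕ∞) ≤ ∞)).eventually (by simp)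
        |>.mono fun w hw => hw.differentiableAt (by simp)
    have h1 : Tendsto (fun t : ℝ => fderiv ℝ E (t • v) v / (2 * t)) (𝓝[>] 0) (𝓝 (D2 v v / 2)) := by
      have h2 : HasDerivAt (fun t : ℝ => fderiv ℝ E (t • v) v) (D2 v v) 0 := by
        have h3 : HasDerivAt (fun t : ℝ => t • v) v 0 := by
          simpa using (hasDerivAt_id (0 : ℝ)).smul_const v
        have h4 : HasFDerivAt (fderiv ℝ E) D2 ((0 : ℝ) • v) := by rwa [zero_smul]
        exact (ContinuousLinearMap.apply ℝ ℝ v).hasFDerivAt.comp_hasDerivAt (0 : ℝ)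
          (h4.comp_hasDerivAt (0 : ℝ) h3)
      have h5 := (hasDerivAt_iff_tendsto_slope.1 h2).mono_left
        (nhdsWithin_mono 0 fun t (ht : 0 < t) => ht.ne')
      refine (h5.div_const 2).congr fun t => ?_
      simp [slope_def_field, hD0]
      ring
    have h2 : Tendsto (fun t : ℝ => E (t • v) / t ^ 2) (𝓝[>] 0) (𝓝 (D2 v v / 2)) := by
      refine HasDerivAt.lhopital_zero_nhdsGT (f' := fun t => fderiv ℝ E (t • v) v)
        (g' := fun t => 2 * t) ?_ ?_ ?_ ?_ ?_ h1
      · filter_upwards [hline.eventually hdiff] with t ht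
        have h3 : HasDerivAt (fun t : ℝ => t • v) v t := by
          simpa using (hasDerivAt_id t).smul_const v
        exact ht.hasFDerivAt.comp_hasDerivAt t h3
      · exact Eventually.of_forall fun t => by simpa using hasDerivAt_pow 2 t
      · filter_upwards [self_mem_nhdsWithin] with t ht using mul_ne_zero two_ne_zero (ne_of_gt ht)
      · simpa [hE0, Function.comp_def] using hE.continuousAt.tendsto.comp hline
      · have : ContinuousAt (fun t : ℝ => t ^ 2) 0 := by fun_prop
        simpa using this.tendsto.mono_left nhdsWithin_le_nhds
    have h3 : Tendsto (fun t : ℝ => E (t • v) / t ^ 2) (𝓝[>] 0) (𝓝 0) := by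
      have h4 : (fun t : ℝ => E (t • v)) =O[𝓝[>] 0] fun t : ℝ => t ^ 3 := by
        refine (hO.comp_tendsto hline).trans ?_
        refine Asymptotics.IsBigO.of_bound (‖v‖ ^ 3) (Eventually.of_forall fun t => ?_)
        simp only [Function.comp, norm_smul, mul_pow, norm_mul, norm_pow, norm_norm]
        rw [mul_comm]
      have h5 : (fun t : ℝ => t ^ 3) =o[𝓝[>] 0] fun t : ℝ => t ^ 2 :=
        (Asymptotics.isLittleO_pow_pow (by norm_num)).mono nhdsWithin_le_nhds
      exact (h4.trans_isLittleO h5).tendsto_div_nhds_zero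
    linarith [tendsto_nhds_unique h2 h3]
  have h1 : ∀ w, ‖fderiv ℝ E w w‖ ≤ ‖(fderiv ℝ E w - D2 w)‖ * ‖w‖ := fun w => by
    simpa [hdiag] using (fderiv ℝ E w - D2 w).le_opNorm w
  have h2 : (fun w : V => ‖(fderiv ℝ E w - D2 w)‖ * ‖w‖) =o[𝓝 0] fun w => ‖w‖ * ‖w‖ :=
    hlin.norm_norm.mul_isBigO (Asymptotics.isBigO_refl _ _)
  simp only [← pow_two] at h2
  exact (Asymptotics.IsBigO.of_bound' (Eventually.of_forall fun w => by
    simpa [abs_of_nonneg (mul_nonneg (norm_nonneg _) (norm_nonneg w))] using h1 w)).trans_isLittleO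
      h2

/-- A smooth positive definite `2`-homogeneous function remains radially increasing near the origin
after a perturbation of third order. -/
theorem exists_isRadiallyIncreasing_add [FiniteDimensional ℝ V] {Q E : V → ℝ}
    (hQ : ContDiff ℝ ∞ Q) (hQt : ∀ (t : ℝ) z, Q (t • z) = t ^ 2 * Q z) (hpos : ∀ z ≠ 0, 0 < Q z)
    (hE : ContDiffAt ℝ ∞ E 0) (hO : E =O[𝓝 0] fun z => ‖z‖ ^ 3) :
    ∃ r > 0, IsRadiallyIncreasing (fun z => Q z + E z) r := by
  have hE0 : E 0 = 0 := hO.eq_zero_imp.self_of_nhds (by simp)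
  have hQ0 : Q 0 = 0 := by simpa using hQt 0 0
  have hQd : ∀ w, fderiv ℝ Q w w = 2 * Q w := by
    intro w
    have h1 : HasDerivAt (fun t : ℝ => t • w) w 1 := by
      simpa using (hasDerivAt_id (1 : ℝ)).smul_const w
    have h2 : HasFDerivAt Q (fderiv ℝ Q w) ((1 : ℝ) • w) := by
      simpa using (hQ.differentiable (by simp) w).hasFDerivAt
    have h3 := h2.comp_hasDerivAt (1 : ℝ) h1
    have h4 : HasDerivAt (fun t : ℝ => t ^ 2 * Q w) (2 * Q w) 1 := by
      simpa using (hasDerivAt_pow 2 (1 : ℝ)).mul_const (Q w)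
    simp only [Function.comp_def, hQt] at h3
    exact h3.unique h4
  obtain ⟨c, hc, hcQ⟩ : ∃ c > 0, ∀ z, c * ‖z‖ ^ 2 ≤ Q z := by
    rcases subsingleton_or_nontrivial V with hV | hV
    · exact ⟨1, one_pos, fun z => by simp [Subsingleton.elim z 0, hQ0]⟩
    obtain ⟨u, hu, hmin⟩ := (isCompact_sphere (0 : V) 1).exists_isMinOn
      (NormedSpace.sphere_nonempty.2 zero_le_one) hQ.continuous.continuousOn
    have hu0 : u ≠ 0 := ne_zero_of_mem_unit_sphere ⟨u, hu⟩
    refine ⟨Q u, hpos u hu0, fun z => ?_⟩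
    rcases eq_or_ne z 0 with rfl | hz
    · simp [hQ0]
    have hz' : ‖z‖ ≠ 0 := norm_ne_zero_iff.2 hz
    have h1 : Q u ≤ Q (‖z‖⁻¹ • z) := hmin (by simp [norm_smul, hz'])
    have h2 : Q z = ‖z‖ ^ 2 * Q (‖z‖⁻¹ • z) := by
      rw [← hQt, smul_smul, mul_inv_cancel₀ hz', one_smul]
    rw [h2, mul_comm]
    gcongr
  have hsmall := (isLittleO_fderiv_apply_self_of_isBigO_cube hE hO).bound hc
  have hdiff : ∀ᶠ w in 𝓝 (0 : V), DifferentiableAt ℝ E w :=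
    (hE.of_le (by simp : (1 : WithTop ℕ∞) ≤ ∞)).eventually (by simp)
      |>.mono fun w hw => hw.differentiableAt (by simp)
  obtain ⟨r, hr, hball⟩ := Metric.eventually_nhds_iff_ball.1 (hsmall.and hdiff)
  refine ⟨r, hr, by simp [hE0, hQ0], fun w hw =>
    (hQ.differentiable (by simp) w).add (hball w hw).2, fun w hw hw0 => ?_⟩
  have h1 := (hball w hw).1
  rw [fderiv_fun_add (hQ.differentiable (by simp) w) (hball w hw).2, add_apply, hQd]
  simp only [Real.norm_eq_abs, abs_pow, abs_norm] at h1
  have h2 := hpos w hw0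
  linarith [hcQ w, (abs_le.1 h1).1]

end Cubic

/-! ### Elliptic quadratic forms -/

section QuadraticForm

variable {n : ℕ} {A B : Matrix (Fin n) (Fin n) ℂ}

theorem quadPart_smul (t : ℝ) (z : EuclideanSpace ℂ (Fin n)) :
    quadPart A B (t • z) = t ^ 2 * quadPart A B z := by
  rw [quadPart, quadPart, ← Complex.re_ofReal_mul, Finset.mul_sum]
  congr 1
  refine Finset.sum_congr rfl fun j _ => ?_
  rw [Finset.mul_sum]
  refine Finset.sum_congr rfl fun k _ => ?_
  simp only [PiLp.smul_apply, Complex.real_smul, map_mul, Complex.conj_ofReal]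
  push_cast
  ring

/-- Along a line the form is a quadratic polynomial. -/
theorem exists_quadPart_add_smul (w v : EuclideanSpace ℂ (Fin n)) :
    ∃ b : ℝ, ∀ t : ℝ,
      quadPart A B (w + t • v) = quadPart A B w + t * b + t ^ 2 * quadPart A B v := by
  refine ⟨(∑ j, ∑ k, (A j k * (w j * conj (v k) + v j * conj (w k))
    + B j k * (w j * v k + v j * w k)
    + conj (B j k) * (conj (w j) * conj (v k) + conj (v j) * conj (w k)))).re, fun t => ?_⟩
  rw [quadPart, quadPart, quadPart, ← Complex.re_ofReal_mul, ← Complex.re_ofReal_mul,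
    ← Complex.add_re, ← Complex.add_re, Finset.mul_sum, Finset.mul_sum, ← Finset.sum_add_distrib,
    ← Finset.sum_add_distrib]
  congr 1
  refine Finset.sum_congr rfl fun j _ => ?_
  rw [Finset.mul_sum, Finset.mul_sum, ← Finset.sum_add_distrib, ← Finset.sum_add_distrib]
  refine Finset.sum_congr rfl fun k _ => ?_
  simp only [PiLp.add_apply, PiLp.smul_apply, Complex.real_smul, map_add, map_mul,
    Complex.conj_ofReal]
  push_cast
  ring

theorem contDiff_quadPart : ContDiff ℝ ∞ (quadPart A B) := by
  have h1 : ∀ j, ContDiff ℝ ∞ fun z : EuclideanSpace ℂ (Fin n) => z j := fun j =>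
    (contDiff_piLp_apply 2 : ContDiff ℝ ∞ fun z : EuclideanSpace ℂ (Fin n) => z j)
  have h2 : ∀ j, ContDiff ℝ ∞ fun z : EuclideanSpace ℂ (Fin n) => conj (z j) := fun j =>
    Complex.conjCLE.contDiff.comp (h1 j)
  refine Complex.reCLM.contDiff.comp
    (ContDiff.sum fun j _ => ContDiff.sum fun k _ => ?_)
  exact ((contDiff_const.mul ((h1 j).mul (h2 k))).add (contDiff_const.mul ((h1 j).mul (h1 k)))).add
    (contDiff_const.mul ((h2 j).mul (h2 k)))

/-- The terms in `z_j z_k` change sign under multiplication by `i`, so that the Hermitian part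
forces the form to be positive somewhere. -/
theorem exists_quadPart_pos (hn : 1 ≤ n) (hA : A.PosDef) : ∃ z, 0 < quadPart A B z := by
  have hnt : NeZero n := ⟨by omega⟩
  let z : EuclideanSpace ℂ (Fin n) := EuclideanSpace.single 0 1
  have hz : (star (z.ofLp) : Fin n → ℂ) ≠ 0 := by
    intro h
    have := congrFun h 0
    simp [z] at this
  have h1 : 0 < quadPart A B z + quadPart A B (Complex.I • z) := by
    have h2 := (Complex.lt_def.1 (hA.dotProduct_mulVec_pos hz)).1
    have h3 : quadPart A B z + quadPart A B (Complex.I • z) =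
        ((2 : ℝ) * (star (star z.ofLp) ⬝ᵥ A.mulVec (star z.ofLp)) : ℂ).re := by
      rw [quadPart, quadPart, ← Complex.add_re, ← Finset.sum_add_distrib]
      simp only [dotProduct, Matrix.mulVec, Finset.mul_sum]
      congr 1
      refine Finset.sum_congr rfl fun j _ => ?_
      rw [← Finset.sum_add_distrib]
      refine Finset.sum_congr rfl fun k _ => ?_
      simp only [PiLp.smul_apply, smul_eq_mul, map_mul, Complex.conj_I, Pi.star_apply,
        RCLike.star_def, Complex.conj_conj]
      push_cast
      linear_combination (-A j k * (z j * conj (z k)) + B j k * (z j * z k)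
        + conj (B j k) * (conj (z j) * conj (z k))) * Complex.I_sq
    rw [h3, Complex.re_ofReal_mul]
    exact mul_pos two_pos (by simpa using h2)
  by_contra! h
  linarith [h z, h (Complex.I • z)]

/-- An elliptic form is positive definite: its level set `{Q = 1}` is not empty, hence bounded. -/
theorem quadPart_pos_of_isEllipticForm (hn : 1 ≤ n) (h : IsEllipticForm A B)
    (v : EuclideanSpace ℂ (Fin n)) (hv : v ≠ 0) : 0 < quadPart A B v := by
  obtain ⟨z, hz⟩ := exists_quadPart_pos (B := B) hn h.1
  obtain ⟨w, hw⟩ : ∃ w, quadPart A B w = 1 :=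
    ⟨(Real.sqrt (quadPart A B z))⁻¹ • z, by
      rw [quadPart_smul, inv_pow, Real.sq_sqrt hz.le, inv_mul_cancel₀ hz.ne']⟩
  obtain ⟨R, hR⟩ : ∃ R, ∀ z, quadPart A B z = 1 → ‖z‖ ≤ R := by
    rcases h.2 1 one_ne_zero with h1 | ⟨x, L, hL⟩
    · exact absurd hw (Set.eq_empty_iff_forall_notMem.1 h1 w)
    · have h2 : IsCompact {z | quadPart A B z = 1} := by
        rw [hL]
        exact (isCompact_sphere 0 1).image (by fun_prop)
      obtain ⟨R, hR⟩ := h2.isBounded.exists_norm_le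
      exact ⟨R, fun z hz => hR z hz⟩
  have hR0 : 0 ≤ R := (norm_nonneg w).trans (hR w hw)
  -- homogeneity turns the bound on `{Q = 1}` into a lower bound on the cone `{Q > 0}`
  have hbound : ∀ z, 0 < quadPart A B z → ‖z‖ ^ 2 ≤ R ^ 2 * quadPart A B z := by
    intro z hz
    have h1 := hR ((Real.sqrt (quadPart A B z))⁻¹ • z) (by
      rw [quadPart_smul, inv_pow, Real.sq_sqrt hz.le, inv_mul_cancel₀ hz.ne'])
    have hs : 0 < Real.sqrt (quadPart A B z) := Real.sqrt_pos.2 hz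
    rw [norm_smul, norm_inv, Real.norm_of_nonneg hs.le, inv_mul_le_iff₀ hs] at h1
    calc ‖z‖ ^ 2 ≤ (Real.sqrt (quadPart A B z) * R) ^ 2 := by gcongr
      _ = R ^ 2 * quadPart A B z := by rw [mul_pow, Real.sq_sqrt hz.le, mul_comm]
  -- so the closed cone `{Q ≥ 0}` meets the boundary `{Q = 0}` only in the origin
  have hcont : Continuous (quadPart A B) := contDiff_quadPart.continuous
  have key : ∀ v, v ≠ 0 → quadPart A B v ≠ 0 := by
    intro v hv h0
    obtain ⟨b, hb⟩ := exists_quadPart_add_smul (A := A) (B := B) w v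
    obtain ⟨ε, hε, hεb⟩ : ∃ ε : ℝ, (ε = 1 ∨ ε = -1) ∧ 0 ≤ ε * b := by
      rcases le_total 0 b with h | h
      · exact ⟨1, Or.inl rfl, by linarith⟩
      · exact ⟨-1, Or.inr rfl, by linarith⟩
    have h1 : ∀ t : ℝ, 0 ≤ t → ‖w + (ε * t) • v‖ ^ 2 ≤ R ^ 2 * (1 + t * (ε * b)) := by
      intro t ht
      have h2 : quadPart A B (w + (ε * t) • v) = 1 + t * (ε * b) := by rw [hb, hw, h0]; ring
      exact h2 ▸ hbound _ (by rw [h2]; positivity)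
    have h3 : ∀ t : ℝ, 0 ≤ t → (t * ‖v‖ - ‖w‖) ^ 2 ≤ R ^ 2 * (1 + t * (ε * b)) := by
      intro t ht
      refine le_trans (sq_le_sq.2 ?_) (h1 t ht)
      have h4 : ‖(ε * t) • v‖ = t * ‖v‖ := by
        have : ‖ε‖ = 1 := by rcases hε with rfl | rfl <;> simp
        rw [norm_smul, norm_mul, this, one_mul, Real.norm_of_nonneg ht]
      rw [abs_norm, ← h4, add_comm w]
      simpa using abs_norm_sub_norm_le ((ε * t) • v) (-w)
    have hv' : 0 < ‖v‖ := norm_pos_iff.2 hv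
    -- a quadratic polynomial in `t` cannot stay below an affine one
    set c := R ^ 2 * (ε * b) + 2 * ‖v‖ * ‖w‖ with hc
    have hc0 : 0 ≤ c := by positivity
    have h5 := h3 ((c + R ^ 2 + 1) / ‖v‖ ^ 2 + 1) (by positivity)
    set t := (c + R ^ 2 + 1) / ‖v‖ ^ 2 + 1 with ht
    have h6 : t * ‖v‖ ^ 2 = c + R ^ 2 + 1 + ‖v‖ ^ 2 := by rw [ht]; field_simp
    have h7 : 1 ≤ t := by rw [ht]; linarith [show 0 ≤ (c + R ^ 2 + 1) / ‖v‖ ^ 2 by positivity]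
    nlinarith [sq_nonneg ‖w‖, sq_nonneg R, sq_nonneg ‖v‖]
  by_contra! hle
  have hlt : quadPart A B v < 0 := lt_of_le_of_ne hle (key v hv)
  obtain ⟨s, hs, h0⟩ : ∃ s ∈ Set.Icc (0 : ℝ) 1, quadPart A B (AffineMap.lineMap w v s) = 0 := by
    have hc : ContinuousOn (fun s : ℝ => quadPart A B (AffineMap.lineMap w v s)) (Set.Icc 0 1) :=
      (hcont.comp AffineMap.lineMap_continuous).continuousOn
    have := intermediate_value_Icc' zero_le_one hc
    refine this ⟨?_, ?_⟩
    · simpa using hle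
    · simp [hw]
  have hline : AffineMap.lineMap w v s = (0 : EuclideanSpace ℂ (Fin n)) := by
    by_contra hne
    exact key _ hne h0
  -- otherwise `w` and `v` are proportional, and `Q` has the same sign on both
  rw [AffineMap.lineMap_apply_module] at hline
  have hs0 : s ≠ 0 := by
    rintro rfl
    simp only [sub_zero, one_smul, zero_smul, add_zero] at hline
    rw [hline] at hw
    have := quadPart_smul (A := A) (B := B) 0 0
    simp [hw] at this
  have h1 : s • v = (-(1 - s)) • w := by
    rw [neg_smul]
    exact eq_neg_of_add_eq_zero_right hline
  have h2 := congrArg (quadPart A B) h1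
  rw [quadPart_smul, quadPart_smul, hw] at h2
  have h3 : 0 < s ^ 2 := by positivity
  nlinarith [sq_nonneg (-(1 - s))]

/-- Of a nondegenerate elliptic point, only the growth of the graph along rays is kept. -/
theorem IsNondegenerateEllipticAt.exists_isEllipticPoint (hn : 1 ≤ n)
    {Ω : Set (EuclideanSpace ℂ (Fin n) × ℝ)} {p : EuclideanSpace ℂ (Fin n) × ℝ}
    (hp : IsNondegenerateEllipticAt Ω p) : ∃ σ h r, IsEllipticPoint Ω p σ h r := by
  obtain ⟨σ, A, B, E, hloc, -, hell⟩ := hp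
  obtain ⟨U, hU, hE⟩ := hloc.smooth
  obtain ⟨r, hr, hrad⟩ := exists_isRadiallyIncreasing_add contDiff_quadPart quadPart_smul
    (quadPart_pos_of_isEllipticForm hn hell) (hE.contDiffAt hU) hloc.cubic
  refine ⟨σ, _, r, hloc.sign, hr, hrad, ?_⟩
  filter_upwards [hloc.side] with x hx
  rw [hx, sub_neg]

end QuadraticForm

/-! ### Projection to levels along orbits -/

section LevelProjection

variable {K : Type*} [TopologicalSpace K]

/-- If the height increases strictly along all orbits but the equilibria and all these orbits run
from `b` to `t`, then every level strictly between those of `b` and `t` is a cross section of the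
flow; `F x c` is the point at the height `c` on the orbit of `x`. -/
theorem exists_levelProjection {φ : Flow ℝ K} {s : K → ℝ}
    (hs : IsStrictLyapunov φ fun x => -s x) {b t : K}
    (ht : ∀ x, ¬ IsEquilibrium φ x → Tendsto (fun τ => φ τ x) atTop (𝓝 t))
    (hb : ∀ x, ¬ IsEquilibrium φ x → Tendsto (fun τ => φ τ x) atBot (𝓝 b)) :
    ∃ F : K → ℝ → K,
      ContinuousOn (Function.uncurry F) ({x | ¬ IsEquilibrium φ x} ×ˢ Set.Ioo (s b) (s t)) ∧
      ∀ x, ¬ IsEquilibrium φ x → F x (s x) = x ∧ ∀ c ∈ Set.Ioo (s b) (s t),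
        s (F x c) = c ∧ (∃ τ, F x c = φ τ x) ∧ ∀ d ∈ Set.Ioo (s b) (s t), F (F x c) d = F x d := by
  have hsc : Continuous s := hs.continuous.neg.congr fun x => neg_neg (s x)
  have hne : ∀ x τ, ¬ IsEquilibrium φ x → ¬ IsEquilibrium φ (φ τ x) := fun x τ hx h =>
    hx h.of_apply
  have hmono : ∀ x, ¬ IsEquilibrium φ x → StrictMono fun τ => s (φ τ x) := by
    intro x hx τ₁ τ₂ h
    have h1 := hs.lt _ (hne x τ₁ hx) (τ₂ - τ₁) (sub_pos.2 h)
    rw [← φ.map_add, sub_add_cancel] at h1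
    exact neg_lt_neg_iff.1 h1
  have hex : ∀ x, ¬ IsEquilibrium φ x → ∀ c ∈ Set.Ioo (s b) (s t), ∃ τ, s (φ τ x) = c := by
    intro x hx c hc
    have hcont : Continuous fun τ => s (φ τ x) := hsc.comp (by fun_prop)
    obtain ⟨τ₁, h1⟩ := (((hsc.tendsto b).comp (hb x hx)).eventually (gt_mem_nhds hc.1)).exists
    obtain ⟨τ₂, h2⟩ := (((hsc.tendsto t).comp (ht x hx)).eventually (lt_mem_nhds hc.2)).exists
    exact mem_range_of_exists_le_of_exists_ge hcont ⟨τ₁, h1.le⟩ ⟨τ₂, h2.le⟩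
  choose! T hT using hex
  have hT' : ∀ x, ¬ IsEquilibrium φ x → ∀ c ∈ Set.Ioo (s b) (s t), ∀ τ, s (φ τ x) = c → T x c = τ :=
    fun x hx c hc τ h => (hmono x hx).injective ((hT x hx c hc).trans h.symm)
  have hTcont : ContinuousOn (Function.uncurry T)
      ({x | ¬ IsEquilibrium φ x} ×ˢ Set.Ioo (s b) (s t)) := by
    rintro ⟨x, c⟩ ⟨hx, hc⟩
    have hcτ : ∀ τ, Continuous fun p : K × ℝ => s (φ τ p.1) := fun τ => hsc.comp (by fun_prop)
    refine tendsto_order.2 ⟨fun a ha => ?_, fun a ha => ?_⟩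
    · have h1 : s (φ a x) < c := by
        rw [← hT x hx c hc]
        exact hmono x hx ha
      filter_upwards [nhdsWithin_le_nhds ((isOpen_lt (hcτ a) continuous_snd).mem_nhds h1),
        self_mem_nhdsWithin] with p hp hpm
      exact (hmono p.1 hpm.1).lt_iff_lt.1 (lt_of_lt_of_eq hp (hT p.1 hpm.1 p.2 hpm.2).symm)
    · have h1 : c < s (φ a x) := by
        rw [← hT x hx c hc]
        exact hmono x hx ha
      filter_upwards [nhdsWithin_le_nhds ((isOpen_lt continuous_snd (hcτ a)).mem_nhds h1),
        self_mem_nhdsWithin] with p hp hpm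
      exact (hmono p.1 hpm.1).lt_iff_lt.1 (lt_of_eq_of_lt (hT p.1 hpm.1 p.2 hpm.2) hp)
  have hlevel : ∀ x, ¬ IsEquilibrium φ x → s x ∈ Set.Ioo (s b) (s t) := by
    intro x hx
    have hm := hmono x hx
    have h0 : s (φ 0 x) = s x := by rw [φ.map_zero_apply]
    constructor
    · have h1 : s b ≤ s (φ (-1) x) := le_of_tendsto ((hsc.tendsto b).comp (hb x hx))
        ((eventually_le_atBot (-1)).mono fun τ hτ => hm.monotone hτ)
      exact h1.trans_lt (h0 ▸ hm (by norm_num))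
    · have h1 : s (φ 1 x) ≤ s t := ge_of_tendsto ((hsc.tendsto t).comp (ht x hx))
        ((eventually_ge_atTop 1).mono fun τ hτ => hm.monotone hτ)
      exact lt_of_lt_of_le (h0 ▸ hm (by norm_num)) h1
  refine ⟨fun x c => φ (T x c) x, ?_, fun x hx => ⟨?_, fun c hc => ⟨hT x hx c hc, ⟨_, rfl⟩, ?_⟩⟩⟩
  · exact φ.cont'.comp_continuousOn (hTcont.prodMk continuousOn_fst)
  · change φ (T x (s x)) x = x
    rw [hT' x hx _ (hlevel x hx) 0 (by rw [φ.map_zero_apply]), φ.map_zero_apply]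
  · intro d hd
    have h1 : T (φ (T x c) x) d = T x d - T x c := by
      refine hT' _ (hne x _ hx) d hd _ ?_
      rw [← φ.map_add, sub_add_cancel, hT x hx d hd]
    change φ (T (φ (T x c) x) d) (φ (T x c) x) = φ (T x d) x
    rw [h1, ← φ.map_add, sub_add_cancel]

end LevelProjection

/-! ### Quotients and the suspension of a sphere -/

section Topology

/-- In a compact space, points whose values approach a value taken only at `b` approach `b`. -/
theorem comap_nhds_le_nhds_of_unique {K : Type*} [TopologicalSpace K] [CompactSpace K] {s : K → ℝ}
    (hs : Continuous s) {b : K} (hb : ∀ x, s x = s b → x = b) : comap s (𝓝 (s b)) ≤ 𝓝 b := by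
  refine le_nhds_of_unique_clusterPt fun y hy => hb y ?_
  have h1 : ClusterPt (s y) (map s (comap s (𝓝 (s b)))) := hy.map hs.continuousAt tendsto_map
  exact eq_of_nhds_neBot (h1.mono map_comap_le)

/-- Two Hausdorff quotients of a compact space by the same equivalence relation are homeomorphic. -/
theorem nonempty_homeomorph_of_fibers_eq {X Y Z : Type*} [TopologicalSpace X] [CompactSpace X]
    [TopologicalSpace Y] [T2Space Y] [TopologicalSpace Z] [T2Space Z] {f : X → Y} {g : X → Z}
    (hf : Continuous f) (hg : Continuous g) (hfs : f.Surjective) (hgs : g.Surjective)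
    (h : ∀ x x', f x = f x' ↔ g x = g x') : Nonempty (Y ≃ₜ Z) := by
  have h1 : IsQuotientMap (⟨f, hf⟩ : C(X, Y)) := .of_surjective_continuous hfs hf
  have h2 : IsQuotientMap (⟨g, hg⟩ : C(X, Z)) := .of_surjective_continuous hgs hg
  exact ⟨h1.homeomorph.symm.trans ((Homeomorph.Quotient.congrRight h).trans h2.homeomorph)⟩

/-- The unit sphere of a space of dimension `m + 1` is the suspension of the unit sphere of a
hyperplane. -/
theorem exists_suspension_map {V W : Type*} [NormedAddCommGroup V] [NormedSpace ℝ V]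
    [FiniteDimensional ℝ V] [Nontrivial V] [NormedAddCommGroup W] [NormedSpace ℝ W]
    [FiniteDimensional ℝ W] (hVW : Module.finrank ℝ W = Module.finrank ℝ V + 1) {α β : ℝ}
    (hαβ : α < β) :
    ∃ g : Metric.sphere (0 : V) 1 × Set.Icc α β → Metric.sphere (0 : W) 1,
      Continuous g ∧ g.Surjective ∧ ∀ p p', g p = g p' ↔
        p.2 = p'.2 ∧ (p.1 = p'.1 ∨ (p.2 : ℝ) = α ∨ (p.2 : ℝ) = β) := by
  have hdim : Module.finrank ℝ (V × ℝ) = Module.finrank ℝ W := by simp [hVW]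
  let L : (V × ℝ) ≃L[ℝ] W := ContinuousLinearEquiv.ofFinrankEq hdim
  -- the height, normalized to `[-1, 1]`, and the double cone over the sphere
  let τ : ℝ → ℝ := fun c => (2 * c - α - β) / (β - α)
  have hβα : 0 < β - α := sub_pos.2 hαβ
  have hτ1 : ∀ c ∈ Set.Icc α β, |τ c| ≤ 1 := fun c hc => by
    rw [abs_le, le_div_iff₀ hβα, div_le_iff₀ hβα]
    constructor <;> linarith [hc.1, hc.2]
  have hτinj : Function.Injective τ := fun c d h => by
    have := (div_left_inj' hβα.ne').1 h
    linarith
  have hτend : ∀ c, |τ c| = 1 ↔ c = α ∨ c = β := fun c => by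
    rw [abs_eq zero_le_one, div_eq_iff hβα.ne', div_eq_iff hβα.ne']
    constructor
    · rintro (h | h)
      · right; linarith
      · left; linarith
    · rintro (rfl | rfl)
      · right; ring
      · left; ring
  let G : Metric.sphere (0 : V) 1 × Set.Icc α β → V × ℝ := fun p => ((1 - |τ p.2|) • p.1.1, τ p.2)
  have hu : ∀ u : Metric.sphere (0 : V) 1, ‖u.1‖ = 1 := fun u => by simp
  have hG1 : ∀ p, ‖(G p).1‖ + |(G p).2| = 1 := fun p => by
    have : 0 ≤ 1 - |τ p.2| := sub_nonneg.2 (hτ1 _ p.2.2)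
    simp [G, norm_smul, hu, abs_of_nonneg this]
  have hG0 : ∀ p, G p ≠ 0 := fun p h => by simpa [h] using hG1 p
  have hL0 : ∀ p, ‖L (G p)‖ ≠ 0 := fun p => by simpa using hG0 p
  have hGc : Continuous G := by fun_prop
  refine ⟨fun p => ⟨‖L (G p)‖⁻¹ • L (G p), by simp [norm_smul, hL0 p]⟩, ?_, ?_, ?_⟩
  · refine Continuous.subtype_mk ?_ _
    exact ((L.continuous.comp hGc).norm.inv₀ hL0).smul (L.continuous.comp hGc)
  · intro y
    set q := L.symm y.1 with hq
    have hy1 : ‖y.1‖ = 1 := by simp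
    have hq0 : q ≠ 0 := by
      rw [hq]
      simp only [ne_eq, EmbeddingLike.map_eq_zero_iff]
      exact norm_ne_zero_iff.1 (by rw [hy1]; norm_num)
    set l := ‖q.1‖ + |q.2| with hl
    have hl0 : 0 < l := by
      refine lt_of_le_of_ne (by positivity) fun h => hq0 ?_
      have h1 : ‖q.1‖ = 0 := by linarith [norm_nonneg q.1, abs_nonneg q.2]
      have h2 : |q.2| = 0 := by linarith [norm_nonneg q.1, abs_nonneg q.2]
      exact Prod.ext (norm_eq_zero.1 h1) (abs_eq_zero.1 h2)
    obtain ⟨u, hu⟩ : ∃ u : Metric.sphere (0 : V) 1, q.1 = ‖q.1‖ • u.1 := by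
      by_cases h0 : q.1 = 0
      · obtain ⟨u, hu⟩ := NormedSpace.sphere_nonempty (x := (0 : V)) (r := 1) |>.2 zero_le_one
        exact ⟨⟨u, hu⟩, by simp [h0]⟩
      · exact ⟨⟨‖q.1‖⁻¹ • q.1, by simp [norm_smul, h0]⟩, by simp [smul_smul, h0]⟩
    let c : ℝ := ((β - α) * (q.2 / l) + α + β) / 2
    have hcτ : τ c = q.2 / l := by simp only [τ, c]; field_simp; ring
    have hc : c ∈ Set.Icc α β := by
      have h1 : |q.2 / l| ≤ 1 := by
        rw [abs_div, abs_of_pos hl0, div_le_one hl0]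
        linarith [norm_nonneg q.1]
      have h2 := abs_le.1 h1
      constructor <;> simp only [c] <;> nlinarith
    have hGq : G (u, ⟨c, hc⟩) = l⁻¹ • q := by
      have h1 : 1 - |q.2 / l| = l⁻¹ * ‖q.1‖ := by
        rw [abs_div, abs_of_pos hl0]
        field_simp
        linarith
      refine Prod.ext ?_ ?_
      · simp only [G, hcτ, h1, mul_smul, Prod.smul_fst]
        rw [← hu]
      · simp only [G, hcτ, Prod.smul_snd, smul_eq_mul]
        ring
    refine ⟨(u, ⟨c, hc⟩), Subtype.ext ?_⟩
    simp only [hGq, map_smul, hq, L.apply_symm_apply, norm_smul, hy1, norm_inv,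
      Real.norm_of_nonneg hl0.le, mul_one, inv_inv, smul_smul, mul_inv_cancel₀ hl0.ne', one_smul]
  · rintro ⟨u, c⟩ ⟨u', c'⟩
    have hGiff : G (u, c) = G (u', c') ↔ c = c' ∧ (u = u' ∨ (c : ℝ) = α ∨ (c : ℝ) = β) := by
      constructor
      · intro h
        have h1 : c = c' := Subtype.ext (hτinj (congrArg Prod.snd h))
        subst h1
        refine ⟨rfl, ?_⟩
        rw [← hτend, or_iff_not_imp_right]
        intro h2
        have h3 : (1 - |τ c|) ≠ 0 := fun h4 => h2 (by linarith)
        exact Subtype.ext (smul_right_injective V h3 (congrArg Prod.fst h))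
      · rintro ⟨rfl, h⟩
        rw [← hτend] at h
        rcases h with rfl | h
        · rfl
        · simp [G, h]
    rw [← hGiff]
    refine ⟨fun h => ?_, fun h => by simp only [h]⟩
    have h1 : ‖L (G (u, c))‖⁻¹ • G (u, c) = ‖L (G (u', c'))‖⁻¹ • G (u', c') := by
      apply L.injective
      simpa using congrArg Subtype.val h
    -- the two points of the double cone are proportional, and both have `ℓ¹` norm one
    have h2 : ∀ (k : ℝ) (p), 0 < k → ‖(k • G p).1‖ + |(k • G p).2| = k := fun k p hk => by
      rw [Prod.smul_fst, Prod.smul_snd, norm_smul, smul_eq_mul, abs_mul, abs_of_pos hk,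
        Real.norm_of_nonneg hk.le, ← mul_add, hG1, mul_one]
    have hpos : ∀ p, 0 < ‖L (G p)‖⁻¹ := fun p => by have := hL0 p; positivity
    have h3 : ‖L (G (u, c))‖⁻¹ = ‖L (G (u', c'))‖⁻¹ := by
      rw [← h2 _ (u, c) (hpos (u, c)), ← h2 _ (u', c') (hpos (u', c')), h1]
    rw [h3] at h1
    exact smul_right_injective _ (hpos _).ne' h1

end Topology

/-! ### Slices near the lowest point -/

section Cap

variable {V : Type*} [NormedAddCommGroup V] [NormedSpace ℝ V] [FiniteDimensional ℝ V]
  {Ω : Set (V × ℝ)} {b : V × ℝ} {h : V → ℝ} {r : ℝ}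

/-- Slightly above an elliptic lowest point, the slice of the domain is star-shaped, and its
boundary is a sphere, by radial projection. -/
theorem IsEllipticPoint.exists_cap (hb : IsEllipticPoint Ω b 1 h r) (hΩ : IsOpen Ω)
    (hbd : Bornology.IsBounded Ω) (hbΩ : b ∈ closure Ω)
    (hmin : ∀ x ∈ closure Ω, x ≠ b → b.2 < x.2) {β : ℝ} (hβ : b.2 < β) :
    ∃ a ∈ Set.Ioo b.2 β, IsConnected {z | (z, a) ∈ Ω} ∧
      Nonempty ({z | (z, a) ∈ frontier Ω} ≃ₜ Metric.sphere (0 : V) 1) := by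
  obtain ⟨δ, hδ, hδN⟩ := Metric.eventually_nhds_iff_ball.1
    (hb.eventually_mem_ball.and hb.side.eventually_nhds)
  have hK : IsCompact (closure Ω) := Metric.isCompact_of_isClosed_isBounded isClosed_closure
    hbd.closure
  -- points of the closed domain at low height are close to `b`
  obtain ⟨ε, hε, hεδ⟩ : ∃ ε > 0, ∀ y ∈ closure Ω, y.2 < b.2 + ε → y ∈ Metric.ball b (δ / 2) := by
    have : CompactSpace (closure Ω) := isCompact_iff_compactSpace.1 hK
    have h1 := comap_nhds_le_nhds_of_unique (K := closure Ω) (s := fun x => (x : V × ℝ).2)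
      (by fun_prop) (b := ⟨b, hbΩ⟩) fun x hx => by
        by_contra hne
        exact (hmin x x.2 fun h => hne (Subtype.ext h)).ne' hx
    have h2 : {y : closure Ω | (y : V × ℝ) ∈ Metric.ball b (δ / 2)} ∈ 𝓝 (⟨b, hbΩ⟩ : closure Ω) :=
      continuous_subtype_val.continuousAt.preimage_mem_nhds (Metric.ball_mem_nhds b (half_pos hδ))
    obtain ⟨U, hU, hUs⟩ := h1 h2
    obtain ⟨ε, hε, hball⟩ := Metric.mem_nhds_iff.1 hU
    refine ⟨ε, hε, fun y hy hlt => hUs (a := ⟨y, hy⟩) (hball ?_)⟩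
    have hle : b.2 ≤ y.2 := by
      rcases eq_or_ne y b with rfl | hne
      · exact le_rfl
      · exact (hmin y hy hne).le
    change dist y.2 b.2 < ε
    rw [Real.dist_eq, abs_of_nonneg (by linarith)]
    linarith
  obtain ⟨η, hη, hηε, hηδ, hηβ⟩ : ∃ η > 0, η < ε ∧ η < δ ∧ η < β - b.2 := by
    obtain ⟨η, h1, h2⟩ := exists_between (lt_min hε (lt_min hδ (sub_pos.2 hβ)))
    simp only [lt_min_iff] at h2
    exact ⟨η, h1, h2⟩
  set a := b.2 + η with ha
  have hnear : ∀ z, (z, a) ∈ closure Ω → ‖z - b.1‖ < δ / 2 := fun z hz => by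
    have h1 := hεδ _ hz (by simp only [ha]; linarith)
    rw [Metric.mem_ball, Prod.dist_eq, max_lt_iff, dist_eq_norm] at h1
    exact h1.1
  have hmemball : ∀ w, ‖w‖ < δ → (b.1 + w, a) ∈ Metric.ball b δ := fun w hw => by
    rw [Metric.mem_ball, Prod.dist_eq, max_lt_iff]
    constructor
    · simpa using hw
    · simpa [ha, abs_of_pos hη] using hηδ
  have hwr : ∀ w : V, ‖w‖ < δ → w ∈ Metric.ball 0 r := fun w hw => by
    simpa using (hδN _ (hmemball w hw)).1
  have hiff : ∀ w, ‖w‖ < δ → ((b.1 + w, a) ∈ Ω ↔ h w < η) := fun w hw => by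
    have h1 := (hδN _ (hmemball w hw)).2.self_of_nhds
    simpa [ha] using h1
  have hbdry : ∀ z, (z, a) ∈ frontier Ω → h (z - b.1) = η := by
    intro z hz
    have hzn : ‖z - b.1‖ < δ := (hnear z hz.1).trans (half_lt_self hδ)
    have h1 := hδN _ (hmemball _ hzn)
    rw [add_sub_cancel] at h1
    have h2 := eq_zero_of_mem_frontier_of_eventually hΩ hz (hb.hasFDerivAt h1.1).continuousAt h1.2
    simp only [ha, add_sub_cancel_left, one_mul] at h2
    linarith
  have hbdry' : ∀ w, ‖w‖ < δ → h w = η → (b.1 + w, a) ∈ frontier Ω := by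
    intro w hw hwη
    have hw0 : w ≠ 0 := by
      rintro rfl
      exact hη.ne (hb.radial.zero.symm.trans hwη)
    rw [hΩ.frontier_eq]
    refine ⟨mem_closure_of_tendsto (f := fun t : ℝ => (b.1 + t • w, a)) (b := 𝓝[<] 1) ?_ ?_,
      fun hcon => absurd ((hiff w hw).1 hcon) (by simp [hwη])⟩
    · have h1 : ContinuousAt (fun t : ℝ => (b.1 + t • w, a)) 1 := by fun_prop
      simpa using h1.tendsto.mono_left nhdsWithin_le_nhds
    · filter_upwards [Ioo_mem_nhdsLT zero_lt_one] with t ht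
      have h1 : ‖t • w‖ < δ := by
        rw [norm_smul, Real.norm_of_nonneg ht.1.le]
        exact (mul_le_of_le_one_left (norm_nonneg w) ht.2.le).trans_lt hw
      rw [hiff _ h1, ← hwη]
      simpa using hb.radial.strictMonoOn (hwr w hw) hw0 (Set.Ioo_subset_Icc_self ht)
        (Set.right_mem_Icc.2 zero_le_one) ht.2
  refine ⟨a, ⟨by linarith, by linarith⟩, ?_, ?_⟩
  · refine (StarConvex.isPathConnected (a := b.1) ?_ ?_).isConnected
    · intro z hz p q hp hq hpq
      have hzn : ‖z - b.1‖ < δ := (hnear z (subset_closure hz)).trans (half_lt_self hδ)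
      have h1 : p • b.1 + q • z = b.1 + q • (z - b.1) := by
        rw [← eq_sub_iff_add_eq] at hpq
        rw [hpq]
        module
      have hq1 : q ≤ 1 := by linarith
      have h2 : ‖q • (z - b.1)‖ < δ := by
        rw [norm_smul, Real.norm_of_nonneg hq]
        exact (mul_le_of_le_one_left (norm_nonneg _) hq1).trans_lt hzn
      change (p • b.1 + q • z, a) ∈ Ω
      rw [h1, hiff _ h2]
      have h3 : h (z - b.1) < η := (hiff _ hzn).1 (by rw [add_sub_cancel]; exact hz)
      rcases eq_or_ne (z - b.1) 0 with h0 | h0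
      · rw [h0, smul_zero, hb.radial.zero]
        exact hη
      · refine lt_of_le_of_lt ?_ h3
        simpa using (hb.radial.strictMonoOn (hwr _ hzn) h0).monotoneOn ⟨hq, hq1⟩
          (Set.right_mem_Icc.2 zero_le_one) hq1
    · change (b.1, a) ∈ Ω
      have := (hiff 0 (by simpa using hδ)).2 (by rw [hb.radial.zero]; exact hη)
      rwa [add_zero] at this
  · have hne : ∀ z : {z | (z, a) ∈ frontier Ω}, z.1 - b.1 ≠ 0 := fun z hz => by
      have := hbdry z.1 z.2
      rw [hz, hb.radial.zero] at this
      exact hη.ne this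
    have hcomp : CompactSpace {z | (z, a) ∈ frontier Ω} := by
      have h1 : IsClosed {z : V | (z, a) ∈ frontier Ω} :=
        isClosed_frontier.preimage (by fun_prop : Continuous fun z : V => (z, a))
      refine isCompact_iff_compactSpace.1 ((isCompact_closedBall b.1 δ).of_isClosed_subset h1 ?_)
      intro z hz
      have h2 := hnear z hz.1
      rw [mem_closedBall_iff_norm]
      linarith
    let f : {z | (z, a) ∈ frontier Ω} → Metric.sphere (0 : V) 1 := fun z =>
      ⟨‖z.1 - b.1‖⁻¹ • (z.1 - b.1), by simp [norm_smul, hne z]⟩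
    have hf : Continuous f := by
      refine Continuous.subtype_mk ?_ _
      have h1 : Continuous fun z : {z | (z, a) ∈ frontier Ω} => z.1 - b.1 := by fun_prop
      exact (h1.norm.inv₀ fun z => norm_ne_zero_iff.2 (hne z)).smul h1
    -- on each ray the level `η` of `h` is attained at most once
    have hinj : ∀ w w', ‖w‖ < δ → ‖w'‖ < δ → h w = η → h w' = η → w ≠ 0 → w' ≠ 0 →
        ‖w‖⁻¹ • w = ‖w'‖⁻¹ • w' → ‖w'‖ ≤ ‖w‖ → w = w' := by
      intro w w' hw hw' hwη hwη' h0 h0' heq hle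
      have hn : ‖w‖ ≠ 0 := norm_ne_zero_iff.2 h0
      have h1 : w' = (‖w'‖ / ‖w‖) • w := by
        rw [div_eq_mul_inv, mul_smul, heq, smul_smul, mul_inv_cancel₀ (norm_ne_zero_iff.2 h0'),
          one_smul]
      have h2 : ‖w'‖ / ‖w‖ ∈ Set.Icc (0 : ℝ) 1 :=
        ⟨by positivity, div_le_one_of_le₀ hle (norm_nonneg _)⟩
      have h3 := (hb.radial.strictMonoOn (hwr w hw) h0).injOn h2 (Set.right_mem_Icc.2 zero_le_one)
        (by simp only [one_smul]; rw [← h1, hwη', hwη])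
      rw [h1, h3, one_smul]
    have hbij : Function.Bijective f := by
      constructor
      · intro z z' hzz
        have heq : ‖z.1 - b.1‖⁻¹ • (z.1 - b.1) = ‖z'.1 - b.1‖⁻¹ • (z'.1 - b.1) :=
          congrArg Subtype.val hzz
        have hz := (hnear z.1 z.2.1).trans (half_lt_self hδ)
        have hz' := (hnear z'.1 z'.2.1).trans (half_lt_self hδ)
        refine Subtype.ext (sub_left_injective (b := b.1) ?_)
        rcases le_total ‖z'.1 - b.1‖ ‖z.1 - b.1‖ with hle | hle
        · exact hinj _ _ hz hz' (hbdry _ z.2) (hbdry _ z'.2) (hne z) (hne z') heq hle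
        · exact (hinj _ _ hz' hz (hbdry _ z'.2) (hbdry _ z.2) (hne z') (hne z) heq.symm hle).symm
      · intro u
        have hu : ‖u.1‖ = 1 := by simp
        have hvδ : ‖(δ / 2) • u.1‖ = δ / 2 := by
          rw [norm_smul, hu, mul_one, Real.norm_of_nonneg (half_pos hδ).le]
        have hvlt : ‖(δ / 2) • u.1‖ < δ := hvδ.trans_lt (half_lt_self hδ)
        have hv : η ≤ h ((δ / 2) • u.1) := by
          by_contra! hlt
          have h1 := hnear _ (subset_closure ((hiff _ hvlt).2 hlt))
          rw [add_sub_cancel_left, hvδ] at h1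
          exact lt_irrefl _ h1
        have hlt : ∀ t ∈ Set.Icc (0 : ℝ) 1, ‖t • (δ / 2) • u.1‖ < δ := fun t ht => by
          rw [norm_smul, Real.norm_of_nonneg ht.1]
          exact (mul_le_of_le_one_left (norm_nonneg _) ht.2).trans_lt hvlt
        have hc : ContinuousOn (fun t : ℝ => h (t • (δ / 2) • u.1)) (Set.Icc 0 1) := fun t ht => by
          have h1 := (hb.radial.differentiableAt _ (hwr _ (hlt t ht))).continuousAt
          exact (h1.comp (f := fun t : ℝ => t • (δ / 2) • u.1) (by fun_prop)).continuousWithinAt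
        obtain ⟨t, ht, htη⟩ := intermediate_value_Icc zero_le_one hc
          (show η ∈ Set.Icc _ _ from ⟨by simpa [hb.radial.zero] using hη.le, by simpa using hv⟩)
        simp only at htη
        have ht0 : 0 < t := by
          refine lt_of_le_of_ne ht.1 ?_
          rintro rfl
          rw [zero_smul, hb.radial.zero] at htη
          exact hη.ne htη
        refine ⟨⟨b.1 + t • (δ / 2) • u.1, hbdry' _ (hlt t ht) htη⟩, Subtype.ext ?_⟩
        have h3 : 0 < t * (δ / 2) := mul_pos ht0 (half_pos hδ)
        simp only [f, add_sub_cancel_left, smul_smul, norm_smul, hu, mul_one,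
          Real.norm_of_nonneg h3.le, inv_mul_cancel₀ h3.ne', one_smul]
    exact ⟨Continuous.homeoOfEquivCompactToT2 (f := Equiv.ofBijective f hbij) hf⟩

end Cap

/-! ### Topology of the domain and of its slices -/

section Domain

variable {V : Type*} [NormedAddCommGroup V] [NormedSpace ℝ V] [FiniteDimensional ℝ V]
  {Ω : Set (V × ℝ)} {ρ : V × ℝ → ℝ}

/-- The dynamical picture of a domain all of whose critical boundary points are elliptic: there are
just two such points, the lowest and the highest one, and the ascending flow projects the closed
domain without these points onto each of the levels in between. -/
theorem exists_poles_levelProjection (hρ : ContDiff ℝ ∞ ρ) (hΩ : ∀ x, x ∈ Ω ↔ ρ x < 0)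
    (hfr : ∀ x ∈ frontier Ω, ρ x = 0 ∧ fderiv ℝ ρ x ≠ 0) (hcon : IsConnected Ω)
    (hbd : Bornology.IsBounded Ω)
    (hell : ∀ x ∈ frontier Ω, IsHeightCritical ρ x → ∃ σ h r, IsEllipticPoint Ω x σ h r) :
    ∃ (b t : closure Ω) (F : closure Ω → ℝ → closure Ω),
      (b : V × ℝ).2 < (t : V × ℝ).2 ∧
      (∀ x : V × ℝ, x ∈ frontier Ω ∧ IsHeightCritical ρ x ↔ x = b ∨ x = t) ∧
      (∀ x, x ≠ b → x ≠ t → (x : V × ℝ).2 ∈ Set.Ioo (b : V × ℝ).2 (t : V × ℝ).2) ∧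
      ContinuousOn (Function.uncurry F)
        ({x | x ≠ b ∧ x ≠ t} ×ˢ Set.Ioo (b : V × ℝ).2 (t : V × ℝ).2) ∧
      ∀ x, x ≠ b → x ≠ t → F x (x : V × ℝ).2 = x ∧
        ∀ c ∈ Set.Ioo (b : V × ℝ).2 (t : V × ℝ).2, (F x c : V × ℝ).2 = c ∧
          ((F x c : V × ℝ) ∈ Ω ↔ (x : V × ℝ) ∈ Ω) ∧
          ∀ d ∈ Set.Ioo (b : V × ℝ).2 (t : V × ℝ).2, F (F x c) d = F x d := by
  have hΩo : IsOpen Ω := by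
    have : Ω = ρ ⁻¹' Set.Iio 0 := Set.ext hΩ
    exact this ▸ isOpen_Iio.preimage hρ.continuous
  have hcompact : CompactSpace (closure Ω) := isCompact_iff_compactSpace.1
    (Metric.isCompact_of_isClosed_isBounded isClosed_closure hbd.closure)
  obtain ⟨φ, hφΩ, hφ, hφe⟩ := exists_ascending_flow hρ hΩ (fun x hx => (hfr x hx).1) hbd
  let Ω' : Set (closure Ω) := {x | (x : V × ℝ) ∈ Ω}
  have himage : (Subtype.val '' Ω' : Set (V × ℝ)) = Ω := by
    ext x
    exact ⟨fun ⟨y, hy, hyx⟩ => hyx ▸ hy, fun hx => ⟨⟨x, subset_closure hx⟩, hx, rfl⟩⟩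
  have hcon' : IsConnected Ω' := by
    refine ⟨?_, IsInducing.subtypeVal.isPreconnected_image.1 (himage.symm ▸ hcon.isPreconnected)⟩
    exact Set.image_nonempty.1 (himage.symm ▸ hcon.nonempty)
  have hdense : Dense Ω' := Subtype.dense_iff.2 (by rw [himage])
  have hΩe : ∀ x ∈ Ω', ¬ IsEquilibrium φ x := fun x hx he => by
    have := (hφe x).1 he
    rw [hΩo.frontier_eq] at this
    exact this.1.2 hx
  obtain ⟨t, b, ht, hb, hbt, hmain⟩ := hφ.exists_source_sink (fun e he => by
    obtain ⟨hef, hec⟩ := (hφe e).1 he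
    obtain ⟨σ, h, r, hE⟩ := hell e hef hec
    have htend : Tendsto Subtype.val (𝓝[≠] e) (𝓝[≠] (e : V × ℝ)) :=
      tendsto_nhdsWithin_iff.2 ⟨continuous_subtype_val.continuousAt.tendsto.mono_left
        nhdsWithin_le_nhds, eventually_mem_nhdsWithin.mono fun y hy h => hy (Subtype.ext h)⟩
    refine ⟨(htend.eventually (hE.eventually_not_isHeightCritical hρ hΩ hfr)).mono
      fun y hy hye => hy ((hφe y).1 hye).1 ((hφe y).1 hye).2, ?_⟩
    have hlt := htend.eventually hE.eventually_lt
    rcases hE.sign with rfl | rfl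
    · right
      filter_upwards [hlt] with y hy
      linarith [hy y.2]
    · left
      filter_upwards [hlt] with y hy
      linarith [hy y.2]) hcon' hdense hΩe
  have heq : ∀ x, ¬ IsEquilibrium φ x ↔ x ≠ b ∧ x ≠ t := fun x => by
    refine ⟨fun h => ⟨?_, ?_⟩, fun h he => (hbt x he).elim h.2 h.1⟩
    · rintro rfl; exact h hb
    · rintro rfl; exact h ht
  obtain ⟨F, hFc, hF⟩ := exists_levelProjection hφ (fun x hx => (hmain x hx).1)
    (fun x hx => (hmain x hx).2.1)
  simp only [heq] at hFc
  have hlev : ∀ x, x ≠ b → x ≠ t → (x : V × ℝ).2 ∈ Set.Ioo (b : V × ℝ).2 (t : V × ℝ).2 :=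
    fun x h1 h2 => by
      obtain ⟨-, -, h3, h4⟩ := hmain x ((heq x).2 ⟨h1, h2⟩)
      exact ⟨neg_lt_neg_iff.1 h4, neg_lt_neg_iff.1 h3⟩
  refine ⟨b, t, F, ?_, fun x => ⟨fun h => ?_, ?_⟩, hlev, hFc, fun x h1 h2 => ?_⟩
  · obtain ⟨x, hx⟩ := hcon'.nonempty
    have h1 := (heq x).1 (hΩe x hx)
    have h2 := hlev x h1.1 h1.2
    exact h2.1.trans h2.2
  · rcases hbt ⟨x, h.1.1⟩ ((hφe _).2 h) with h1 | h1
    · exact Or.inr (congrArg Subtype.val h1)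
    · exact Or.inl (congrArg Subtype.val h1)
  · rintro (rfl | rfl)
    exacts [(hφe b).1 hb, (hφe t).1 ht]
  · obtain ⟨h3, h4⟩ := hF x ((heq x).2 ⟨h1, h2⟩)
    refine ⟨h3, fun c hc => ?_⟩
    obtain ⟨h5, ⟨τ, h6⟩, h7⟩ := h4 c hc
    exact ⟨h5, by rw [h6, hφΩ], h7⟩

/-- A smoothly bounded domain in `V × ℝ` all of whose critical boundary points for the height are
elliptic has just two such points, its boundary is a sphere, and its slices are smoothly bounded
domains with connected boundary. -/
theorem sphere_and_slices_of_isEllipticPoint {W : Type*} [NormedAddCommGroup W] [NormedSpace ℝ W]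
    [FiniteDimensional ℝ W] (hV : 1 < Module.rank ℝ V)
    (hVW : Module.finrank ℝ W = Module.finrank ℝ V + 1) (hρ : ContDiff ℝ ∞ ρ)
    (hΩ : ∀ x, x ∈ Ω ↔ ρ x < 0) (hfr : ∀ x ∈ frontier Ω, ρ x = 0 ∧ fderiv ℝ ρ x ≠ 0)
    (hcon : IsConnected Ω) (hbd : Bornology.IsBounded Ω)
    (hell : ∀ x ∈ frontier Ω, IsHeightCritical ρ x → ∃ σ h r, IsEllipticPoint Ω x σ h r) :
    Nonempty (frontier Ω ≃ₜ Metric.sphere (0 : W) 1) ∧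
      (∃ b t, b ≠ t ∧ ∀ x, x ∈ frontier Ω ∧ IsHeightCritical ρ x ↔ x = b ∨ x = t) ∧
      ∀ c : ℝ, {z | (z, c) ∈ Ω}.Nonempty →
        IsSmoothlyBoundedDomain {z | (z, c) ∈ Ω} ∧ IsConnected (frontier {z | (z, c) ∈ Ω}) := by
  have hΩo : IsOpen Ω := by
    have : Ω = ρ ⁻¹' Set.Iio 0 := Set.ext hΩ
    exact this ▸ isOpen_Iio.preimage hρ.continuous
  have hcompact : CompactSpace (closure Ω) := isCompact_iff_compactSpace.1
    (Metric.isCompact_of_isClosed_isBounded isClosed_closure hbd.closure)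
  have hnt : Nontrivial V := rank_pos_iff_nontrivial.1 (zero_lt_one.trans hV)
  obtain ⟨b, t, F, hlt, hcrit, hlev, hFc, hF⟩ :=
    exists_poles_levelProjection hρ hΩ hfr hcon hbd hell
  set α := (b : V × ℝ).2 with hα
  set β := (t : V × ℝ).2 with hβ
  have hbfr := (hcrit b).2 (Or.inl rfl)
  have htfr := (hcrit t).2 (Or.inr rfl)
  have hne : ∀ x : closure Ω, (x : V × ℝ).2 ∈ Set.Ioo α β → x ≠ b ∧ x ≠ t := fun x hx =>
    ⟨by rintro rfl; exact lt_irrefl _ hx.1, by rintro rfl; exact lt_irrefl _ hx.2⟩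
  have hbuniq : ∀ x : closure Ω, (x : V × ℝ).2 = α → x = b := fun x hx => by
    by_contra hxb
    by_cases hxt : x = t
    · exact hlt.ne (hx.symm.trans (hxt ▸ rfl))
    · exact (hlev x hxb hxt).1.ne hx.symm
  have htuniq : ∀ x : closure Ω, (x : V × ℝ).2 = β → x = t := fun x hx => by
    by_contra hxt
    by_cases hxb : x = b
    · exact hlt.ne (by rw [← hx, hxb])
    · exact (hlev x hxb hxt).2.ne hx
  have hmin : ∀ x ∈ closure Ω, x ≠ b → α < x.2 := fun x hx hxb => by
    by_cases hxt : x = t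
    · exact hxt ▸ hlt
    · exact (hlev ⟨x, hx⟩ (fun h => hxb (congrArg Subtype.val h))
        fun h => hxt (congrArg Subtype.val h)).1
  have hfrΩ : ∀ x : closure Ω, (x : V × ℝ) ∈ frontier Ω ↔ (x : V × ℝ) ∉ Ω := fun x => by
    rw [hΩo.frontier_eq]
    exact ⟨fun h => h.2, fun h => ⟨x.2, h⟩⟩
  -- at the lowest point the domain lies above the graph
  obtain ⟨h, r, hE⟩ : ∃ h r, IsEllipticPoint Ω (b : V × ℝ) 1 h r := by
    obtain ⟨σ, h, r, hE⟩ := hell b hbfr.1 hbfr.2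
    rcases hE.sign with rfl | rfl
    · exact ⟨h, r, hE⟩
    · obtain ⟨y, hy, h1⟩ := ((mem_closure_iff_frequently.1 b.2).and_eventually
        (eventually_nhdsWithin_iff.1 hE.eventually_lt)).exists
      have hyb : y ≠ b := by
        rintro rfl
        exact (hfrΩ b).1 hbfr.1 hy
      have h2 := h1 hyb (subset_closure hy)
      linarith [hmin y (subset_closure hy) hyb]
  obtain ⟨a, ha, hconn, ⟨e⟩⟩ := hE.exists_cap hΩo hbd b.2 hmin hlt
  -- the level projection maps slices onto slices
  have hslice : ∀ S : Set (V × ℝ), S ⊆ closure Ω →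
      (∀ x : closure Ω, x ≠ b → x ≠ t → ∀ c ∈ Set.Ioo α β,
        ((F x c : V × ℝ) ∈ S ↔ (x : V × ℝ) ∈ S)) →
      IsConnected {z | (z, a) ∈ S} → ∀ c ∈ Set.Ioo α β, IsConnected {z | (z, c) ∈ S} := by
    intro S hS hFS hSc c hc
    have hsp : ConnectedSpace {z | (z, a) ∈ S} := isConnected_iff_connectedSpace.1 hSc
    let G : {z | (z, a) ∈ S} → V := fun z => (F ⟨(z.1, a), hS z.2⟩ c : V × ℝ).1
    have hG : Continuous G := by
      have h1 : Continuous fun z : {z | (z, a) ∈ S} =>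
          ((⟨(z.1, a), hS z.2⟩ : closure Ω), c) := by fun_prop
      have h2 := hFc.comp_continuous h1 fun z => ⟨hne _ ha, hc⟩
      exact (continuous_subtype_val.comp h2).fst
    have hrange : Set.range G = {z | (z, c) ∈ S} := by
      ext z
      constructor
      · rintro ⟨w, rfl⟩
        obtain ⟨h1, h2⟩ := hne ⟨(w.1, a), hS w.2⟩ ha
        have h3 := (hFS _ h1 h2 c hc).2 w.2
        have h4 := ((hF _ h1 h2).2 c hc).1
        change (G w, c) ∈ S
        rwa [← h4]
      · intro hz
        obtain ⟨h1, h2⟩ := hne ⟨(z, c), hS hz⟩ hc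
        have h3 := (hFS _ h1 h2 a ha).2 hz
        obtain ⟨h4, -, h5⟩ := (hF _ h1 h2).2 a ha
        have h6 : (((F ⟨(z, c), hS hz⟩ a : V × ℝ).1, a) : V × ℝ) = F ⟨(z, c), hS hz⟩ a :=
          Prod.ext rfl h4.symm
        refine ⟨⟨_, Set.mem_ofPred_eq ▸ h6.symm ▸ h3⟩, ?_⟩
        have h7 : (⟨((F ⟨(z, c), hS hz⟩ a : V × ℝ).1, a), hS (h6.symm ▸ h3)⟩ : closure Ω) =
            F ⟨(z, c), hS hz⟩ a := Subtype.ext h6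
        simp only [G, h7, h5 c hc]
        exact congrArg (fun x : closure Ω => (x : V × ℝ).1) (hF _ h1 h2).1
    exact hrange ▸ isConnected_range hG
  have hFfr : ∀ x : closure Ω, x ≠ b → x ≠ t → ∀ c ∈ Set.Ioo α β,
      ((F x c : V × ℝ) ∈ frontier Ω ↔ (x : V × ℝ) ∈ frontier Ω) := fun x h1 h2 c hc => by
    rw [hfrΩ, hfrΩ, ((hF x h1 h2).2 c hc).2.1]
  have hfra : IsConnected {z | (z, a) ∈ frontier Ω} := by
    have h1 : ConnectedSpace (Metric.sphere (0 : V) 1) :=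
      isConnected_iff_connectedSpace.1 (isConnected_sphere hV 0 zero_le_one)
    exact isConnected_iff_connectedSpace.2 (e.symm.surjective.connectedSpace e.symm.continuous)
  refine ⟨?_, ⟨b, t, fun h => hlt.ne (congrArg Prod.snd h), hcrit⟩, fun c hc => ?_⟩
  · obtain ⟨g, hg, hgs, hgf⟩ := exists_suspension_map (W := W) hVW hlt
    have hMa : CompactSpace {z | (z, a) ∈ frontier Ω} := e.symm.compactSpace
    let x₀ : {z | (z, a) ∈ frontier Ω} → closure Ω := fun z => ⟨(z.1, a), z.2.1⟩
    have hx₀ : ∀ z, x₀ z ≠ b ∧ x₀ z ≠ t := fun z => hne (x₀ z) ha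
    -- the cylinder over the boundary of the low slice, mapped onto the boundary along the orbits
    let f₀ : {z | (z, a) ∈ frontier Ω} × Set.Icc α β → closure Ω := fun p =>
      if (p.2 : ℝ) = α then b else if (p.2 : ℝ) = β then t else F (x₀ p.1) p.2
    have hcases : ∀ c : Set.Icc α β, (c : ℝ) = α ∨ (c : ℝ) = β ∨ (c : ℝ) ∈ Set.Ioo α β :=
        fun c => by
      rcases c.2.1.eq_or_lt with h1 | h1
      · exact Or.inl h1.symm
      rcases c.2.2.eq_or_lt with h2 | h2
      · exact Or.inr (Or.inl h2)
      · exact Or.inr (Or.inr ⟨h1, h2⟩)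
    have hfα : ∀ p, (p.2 : ℝ) = α → f₀ p = b := fun p hp => by simp [f₀, hp]
    have hfβ : ∀ p, (p.2 : ℝ) = β → f₀ p = t := fun p hp => by simp [f₀, hp, hlt.ne']
    have hfm : ∀ p, (p.2 : ℝ) ∈ Set.Ioo α β → f₀ p = F (x₀ p.1) p.2 := fun p hp => by
      simp [f₀, hp.1.ne', hp.2.ne]
    have hfs : ∀ p, (f₀ p : V × ℝ).2 = p.2 := fun p => by
      rcases hcases p.2 with h1 | h1 | h1
      · rw [hfα p h1, h1]
      · rw [hfβ p h1, h1]
      · rw [hfm p h1, ((hF _ (hx₀ p.1).1 (hx₀ p.1).2).2 _ h1).1]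
    have hfmem : ∀ p, (f₀ p : V × ℝ) ∈ frontier Ω := fun p => by
      rcases hcases p.2 with h1 | h1 | h1
      · rw [hfα p h1]; exact hbfr.1
      · rw [hfβ p h1]; exact htfr.1
      · rw [hfm p h1, hFfr _ (hx₀ p.1).1 (hx₀ p.1).2 _ h1]; exact p.1.2
    have hfc : Continuous f₀ := by
      -- at the two ends of the cylinder, the height alone controls the position
      have hend : ∀ (x : closure Ω) (p), f₀ p = x →
          (∀ y : closure Ω, (y : V × ℝ).2 = (x : V × ℝ).2 → y = x) → ContinuousAt f₀ p := by
        intro x p hp hx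
        rw [ContinuousAt, hp]
        refine Tendsto.mono_right (tendsto_comap_iff.2 ?_) (comap_nhds_le_nhds_of_unique
          (s := fun y : closure Ω => (y : V × ℝ).2) (by fun_prop) hx)
        rw [← hp, hfs p]
        refine Tendsto.congr (fun q => (hfs q).symm) ?_
        exact (continuous_subtype_val.comp continuous_snd).continuousAt
      rw [continuous_iff_continuousAt]
      intro p
      rcases hcases p.2 with h1 | h1 | h1
      · exact hend b p (hfα p h1) hbuniq
      · exact hend t p (hfβ p h1) htuniq
      · have hO : IsOpen {p : {z | (z, a) ∈ frontier Ω} × Set.Icc α β | (p.2 : ℝ) ∈ Set.Ioo α β} :=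
          isOpen_Ioo.preimage (continuous_subtype_val.comp continuous_snd)
        have h2 : ContinuousOn (fun p : {z | (z, a) ∈ frontier Ω} × Set.Icc α β =>
            F (x₀ p.1) p.2) {p | (p.2 : ℝ) ∈ Set.Ioo α β} :=
          hFc.comp (f := fun p : {z | (z, a) ∈ frontier Ω} × Set.Icc α β => (x₀ p.1, (p.2 : ℝ)))
            (Continuous.continuousOn (by fun_prop)) fun p hp => ⟨hx₀ p.1, hp⟩
        exact (h2.continuousAt (hO.mem_nhds h1)).congr
          ((hO.mem_nhds h1 |> fun h => Filter.mem_of_superset h fun q hq => (hfm q hq).symm))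
    refine nonempty_homeomorph_of_fibers_eq
      (f := fun p => (⟨f₀ p, hfmem p⟩ : frontier Ω)) (g := fun p => g (e p.1, p.2))
      (by fun_prop) (by fun_prop) ?_ ?_ ?_
    · intro y
      obtain ⟨z₀⟩ : Nonempty {z | (z, a) ∈ frontier Ω} := hfra.nonempty.to_subtype
      let y' : closure Ω := ⟨y.1, y.2.1⟩
      by_cases hyb : y' = b
      · exact ⟨(z₀, ⟨α, le_rfl, hlt.le⟩), Subtype.ext
          ((congrArg Subtype.val (hfα _ rfl)).trans (congrArg Subtype.val hyb).symm)⟩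
      by_cases hyt : y' = t
      · exact ⟨(z₀, ⟨β, hlt.le, le_rfl⟩), Subtype.ext
          ((congrArg Subtype.val (hfβ _ rfl)).trans (congrArg Subtype.val hyt).symm)⟩
      have hlev' := hlev y' hyb hyt
      obtain ⟨h1, -, h2⟩ := (hF y' hyb hyt).2 a ha
      have h3 : (((F y' a : V × ℝ).1, a) : V × ℝ) = F y' a := Prod.ext rfl h1.symm
      have h4 : ((F y' a : V × ℝ).1, a) ∈ frontier Ω := by
        rw [h3, hFfr y' hyb hyt a ha]
        exact y.2
      refine ⟨(⟨(F y' a : V × ℝ).1, h4⟩, ⟨y.1.2, hlev'.1.le, hlev'.2.le⟩), Subtype.ext ?_⟩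
      have h5 : x₀ ⟨(F y' a : V × ℝ).1, h4⟩ = F y' a := Subtype.ext h3
      change ((f₀ _ : closure Ω) : V × ℝ) = y'
      rw [hfm _ hlev', h5, h2 _ hlev', (hF y' hyb hyt).1]
    · intro w
      obtain ⟨p, hp⟩ := hgs w
      exact ⟨(e.symm p.1, p.2), by simpa using hp⟩
    · intro p p'
      rw [hgf, Subtype.mk.injEq, Subtype.val_inj, e.injective.eq_iff]
      constructor
      · intro heq
        have hc : p.2 = p'.2 := Subtype.ext (by rw [← hfs, ← hfs, heq])
        refine ⟨hc, ?_⟩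
        rcases hcases p.2 with h1 | h1 | h1
        · exact Or.inr (Or.inl h1)
        · exact Or.inr (Or.inr h1)
        · left
          rw [hfm p h1, hfm p' (hc ▸ h1), ← hc] at heq
          have h2 : ∀ z, F (F (x₀ z) p.2) a = x₀ z := fun z => by
            rw [((hF _ (hx₀ z).1 (hx₀ z).2).2 _ h1).2.2 a ha]
            exact (hF _ (hx₀ z).1 (hx₀ z).2).1
          have h3 : x₀ p.1 = x₀ p'.1 := by rw [← h2, heq, h2]
          exact Subtype.ext (congrArg (fun x : closure Ω => (x : V × ℝ).1) h3)
      · rintro ⟨h1, h2 | h2 | h2⟩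
        · rw [Prod.ext h2 h1]
        · rw [hfα p h2, hfα p' (h1 ▸ h2)]
        · rw [hfβ p h2, hfβ p' (h1 ▸ h2)]
  · have hcI : c ∈ Set.Ioo α β := by
      obtain ⟨z, hz⟩ := hc
      refine hlev ⟨(z, c), subset_closure hz⟩ ?_ ?_
      · intro h1
        exact (hfrΩ b).1 hbfr.1 (h1 ▸ hz)
      · intro h1
        exact (hfrΩ t).1 htfr.1 (h1 ▸ hz)
    have hι : Continuous fun z : V => (z, c) := by fun_prop
    have hopen : IsOpen {z | (z, c) ∈ Ω} := hΩo.preimage hι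
    have hρc : ContDiff ℝ ∞ fun z => ρ (z, c) := hρ.comp (by fun_prop)
    have hfrc : ∀ z, (z, c) ∈ frontier Ω → fderiv ℝ (fun z => ρ (z, c)) z ≠ 0 := by
      intro z hz h0
      have h1 : ¬ IsHeightCritical ρ (z, c) := fun h2 => by
        rcases (hcrit _).1 ⟨hz, h2⟩ with h3 | h3
        · exact hcI.1.ne' (congrArg Prod.snd h3)
        · exact hcI.2.ne (congrArg Prod.snd h3)
      refine h1 fun v => ?_
      have h2 : HasFDerivAt (fun z => ρ (z, c))
          ((fderiv ℝ ρ (z, c)).comp (ContinuousLinearMap.inl ℝ V ℝ)) z :=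
        (hρ.differentiable (by simp) (z, c)).hasFDerivAt.comp z
          ((hasFDerivAt_id z).prodMk (hasFDerivAt_const c z))
      rw [h2.fderiv] at h0
      simpa using DFunLike.congr_fun h0 v
    have hfrontier : frontier {z | (z, c) ∈ Ω} = {z | (z, c) ∈ frontier Ω} := by
      ext z
      constructor
      · intro hz
        rw [hopen.frontier_eq] at hz
        rw [Set.mem_ofPred_eq, hΩo.frontier_eq]
        exact ⟨hι.closure_preimage_subset Ω hz.1, hz.2⟩
      · intro hz
        exact mem_frontier_of_eq_zero (ρ := fun z => ρ (z, c)) (fun z => hΩ (z, c)) (hfr _ hz).1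
          (hfrc z hz)
    refine ⟨⟨hopen, hslice Ω subset_closure
      (fun x h1 h2 c hc => ((hF x h1 h2).2 c hc).2.1) hconn c hcI, ?_, fun z hz =>
        ⟨Set.univ, fun z => ρ (z, c), isOpen_univ, trivial, hρc.contDiffOn,
          hfrc z (hfrontier.subset hz), fun y _ => hΩ (y, c)⟩⟩,
      hfrontier ▸ hslice _ (fun x hx => hx.1) hFfr hfra c hcI⟩
    exact (hbd.image_fst).subset fun z hz => ⟨(z, c), hz, rfl⟩

end Domain

/-! ### Domains with elliptic CR singular points -/

theorem mainTheorem4 (n : ℕ) (hn : 1 ≤ n) (Ω : Set (EuclideanSpace ℂ (Fin n) × ℝ))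
    (hΩ : IsSmoothlyBoundedDomain Ω)
    (hsing : ∀ p ∈ frontier Ω, flatInclusion n p ∈ crSingularSet (boundaryInCn Ω) →
      IsNondegenerateEllipticAt Ω p) :
    Nonempty (frontier Ω ≃ₜ Metric.sphere (0 : EuclideanSpace ℝ (Fin (2 * n + 1))) 1) ∧
    (crSingularSet (boundaryInCn Ω)).ncard = 2 ∧
    ∀ c : ℝ, (slice Ω c).Nonempty →
      IsSmoothlyBoundedDomain (slice Ω c) ∧ IsConnected (frontier (slice Ω c)) := by
  obtain ⟨ρ, hρ, hρΩ, hfr⟩ := exists_global_definingFunction hΩ.isOpen hΩ.hasSmoothBoundary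
  have hfin : Module.finrank ℝ (EuclideanSpace ℂ (Fin n)) = 2 * n := by
    rw [finrank_real_of_complex, finrank_euclideanSpace_fin]
  have hrank : 1 < Module.rank ℝ (EuclideanSpace ℂ (Fin n)) := by
    rw [← Module.finrank_eq_rank, hfin]
    exact_mod_cast (by omega : 1 < 2 * n)
  have hnt : Nontrivial (EuclideanSpace ℂ (Fin n)) :=
    rank_pos_iff_nontrivial.1 (zero_lt_one.trans hrank)
  have hell' : ∀ x ∈ frontier Ω, IsHeightCritical ρ x →
      (¬ ∀ᶠ y in 𝓝[frontier Ω] x, IsHeightCritical ρ y) → ∃ σ h r, IsEllipticPoint Ω x σ h r :=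
    fun x hx hc hne => (hsing x hx
      ((flatInclusion_mem_crSingularSet hρ hρΩ hfr hx).2 ⟨hc, hne⟩)).exists_isEllipticPoint hn
  have hnot := not_eventually_isHeightCritical hρ hρΩ hfr hΩ.isBounded fun x hx hc hne => by
    obtain ⟨σ, h, r, hE⟩ := hell' x hx hc hne
    exact hE.eventually_not_isHeightCritical hρ hρΩ hfr
  obtain ⟨h1, ⟨b, t, hbt, hcrit⟩, h3⟩ := sphere_and_slices_of_isEllipticPoint
    (W := EuclideanSpace ℝ (Fin (2 * n + 1))) hrank (by simp [hfin]) hρ hρΩ hfr hΩ.isConnected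
    hΩ.isBounded fun x hx hc => hell' x hx hc (hnot x hx)
  refine ⟨h1, ?_, h3⟩
  have hset : crSingularSet (boundaryInCn Ω) = {flatInclusion n b, flatInclusion n t} := by
    ext y
    constructor
    · intro hy
      obtain ⟨x, hx, rfl⟩ := hy.1
      have h4 := (flatInclusion_mem_crSingularSet hρ hρΩ hfr hx).1 hy
      rcases (hcrit x).1 ⟨hx, h4.1⟩ with rfl | rfl <;> simp
    · have key : ∀ x, x = b ∨ x = t → flatInclusion n x ∈ crSingularSet (boundaryInCn Ω) := by
        intro x hx
        have h4 := (hcrit x).2 hx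
        exact (flatInclusion_mem_crSingularSet hρ hρΩ hfr h4.1).2 ⟨h4.2, hnot x h4.1⟩
      rintro (rfl | rfl)
      exacts [key b (Or.inl rfl), key t (Or.inr rfl)]
  rw [hset, Set.ncard_pair fun h => hbt (flatInclusion_injective h)]
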